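/- Throughout, $x=(x_1,\dots,x_n)\in\mathbb{R}^{n\times d}$ has rows $x_i\in\mathbb{R}^d$, $\|\cdot\|$ is the Euclidean (Frobenius) norm, $\bar x=\frac1n\sum_{i}x_i$, and solutions of differential equations are Carathéodory solutions on $[0,\infty)$ (or $[s,\infty)$). **Definitions.** An $n\times n$ matrix is a *generalized Laplacian* if its off-diagonal entries are $\le 0$ and its column sums are $0$; it is *weight-balanced* if it and its transpose are generalized Laplacians. For a measurable, locally essentially bounded $L:[0,\infty)\to\mathbb{R}^{n\times n}$, the *transition flow* $\Phi(t,s)$, $t\ge s\ge 0$, is the solution of $\frac{d}{dt}\Phi(t,s)=-L(t)\Phi(t,s)$, $\Phi(s,s)=I$. It is *weakly exponentially ergodic* if there are $a>0$ and $\lambda\in(0,1)$ with $d(\Phi(t,s),\mathbb{S}_1)\le a\lambda^{t-s}$ for all $t\ge s\ge0$, where $\mathbb{S}_1$ is the set of column-stochastic matrices of rank one and $d$ is the distance in the Frobenius norm. An input-output dynamics $\dot x=f(t,x,w,u)$, $\dot w=g(t,x,w,u)$, $y=h(t,x,w)$, with $x,u,y\in\mathbb{R}^{n\times d}$ and $w\in\mathbb{R}^N$,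 is a *distributed flow tracker with respect to* $Q\subseteq\mathbb{R}^{n\times d}\times\mathbb{R}^N$ if there are $c>0$ and $\lambda\in(0,1)$ such that for every locally integrable input $u$ and every trajectory with $(x(0),w(0))\in Q$: (i) $\dot{\bar x}(t)=\bar u(t)$, and (ii) $\|y_i(t)-\bar x(t)\|\le c\big(\lambda^t\|x(0)\|+\int_0^t\lambda^{t-\tau}\|u(\tau)\|\,d\tau\big)$ for all $t\ge0$ and all $i$. **Theorem.** Let $L:[0,\infty)\to\mathbb{R}^{n\times n}$ be measurable and locally essentially bounded, with $L(t)$ weight-balanced for all $t\ge0$, and suppose that its transition flow $\Phi(t,s)$ is weakly exponentially ergodic. Then the dynamics $\dot x=-L(t)x+u$, $y=x$ (with $N=0$) is a distributed flow tracker with respect to $Q=\mathbb{R}^{n\times d}$. Moreover, let $\alpha:[0,\infty)\to[0,\infty)$ be measurable with $\int_0^\infty\alpha(t)\,dt=\infty$ and $\int_0^\infty\alpha(t)^2\,dt<\infty$. Let $f_1,\dots,f_n:\mathbb{R}^d\to\mathbb{R}$ be convex and differentiable functions such that the set $X^*$ of minimizers of $F=\sum_i f_i$ is non-empty and, for some constant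 $K$, $\|\nabla f_i(z)\|\le K(1+\|z\|)$ for all $i$ and $z$ (for instance, all $\nabla f_i$ are bounded, or all are Lipschitz continuous). Let $\nabla\tilde F(x)$ be the $n\times d$ matrix with rows $\nabla f_i(x_i)$. Then for every solution $x$ on $[0,\infty)$ of $$\dot x(t)=-L(t)x(t)-\alpha(t)\nabla\tilde F(x(t)),$$ with any initial condition $x(0)\in\mathbb{R}^{n\times d}$, there is $x^*\in X^*$ such that $\lim_{t\to\infty}x_i(t)=x^*$ for all $i\in\{1,\dots,n\}$. -/

import Mathlib

open Filter Topology MeasureTheory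

noncomputable section

namespace FlowTracker

/-- The joint state of `n` agents, i.e. an `n × d` real matrix given by its rows `x i ∈ ℝ^d`.
Its topology is the usual one; its Euclidean (Frobenius) norm is `stateNorm`. -/
abbrev State (n d : ℕ) : Type := Fin n → EuclideanSpace ℝ (Fin d)

/-- The Euclidean (Frobenius) norm of an `n × d` matrix. -/
def stateNorm {n d : ℕ} (x : State n d) : ℝ := Real.sqrt (∑ i, ‖x i‖ ^ 2)

/-- The average `(1/n) ∑ᵢ xᵢ` of the rows. -/
def average {n d : ℕ} (x : State n d) : EuclideanSpace ℝ (Fin d) := (n : ℝ)⁻¹ • ∑ i, x i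

/-- The matrix product `A x` of an `n × n` matrix with an `n × d` matrix. -/
def act {n d : ℕ} (A : Matrix (Fin n) (Fin n) ℝ) (x : State n d) : State n d :=
  fun i => ∑ j, A i j • x j

/-- `x` is a Carathéodory solution on `[t₀, ∞)` of `ẋ(t) = v(t, x(t))`: it is the indefinite
integral of the (locally integrable) function `τ ↦ v(τ, x(τ))`. -/
def IsCaratheodorySolution {E : Type*} [NormedAddCommGroup E] [NormedSpace ℝ E]
    (v : ℝ → E → E) (t₀ : ℝ) (x : ℝ → E) : Prop :=
  ∀ t, t₀ ≤ t →
    IntervalIntegrable (fun τ => v τ (x τ)) volume t₀ t ∧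
      x t = x t₀ + ∫ τ in t₀..t, v τ (x τ)

/-! ### Laplacians and their transition flows -/

/-- Generalized Laplacian: nonpositive off-diagonal entries and zero column sums (so that
`ẋ = -L x` conserves the sum of the states and has column-stochastic transition matrices). -/
def IsGeneralizedLaplacian {n : ℕ} (A : Matrix (Fin n) (Fin n) ℝ) : Prop :=
  (∀ i j, i ≠ j → A i j ≤ 0) ∧ ∀ j, ∑ i, A i j = 0

/-- Weight-balanced: both `A` and its transpose are generalized Laplacians. -/
def IsWeightBalanced {n : ℕ} (A : Matrix (Fin n) (Fin n) ℝ) : Prop :=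
  IsGeneralizedLaplacian A ∧ IsGeneralizedLaplacian A.transpose

/-- The matrix function `L` on `[0, ∞)` is (Lebesgue) measurable. -/
def IsMeasurableOnHalfLine {n : ℕ} (L : ℝ → Matrix (Fin n) (Fin n) ℝ) : Prop :=
  ∀ i j, AEMeasurable (fun t => L t i j) (volume.restrict (Set.Ici 0))

/-- The matrix function `L` on `[0, ∞)` is locally essentially bounded. -/
def IsLocallyEssentiallyBounded {n : ℕ} (L : ℝ → Matrix (Fin n) (Fin n) ℝ) : Prop :=
  ∀ T : ℝ, ∃ M : ℝ, ∀ᵐ t ∂(volume.restrict (Set.Icc 0 T)), ∀ i j, |L t i j| ≤ M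

section Flow

open scoped Matrix.Norms.Frobenius

/-- `Φ` is the transition flow of `L`: for each `s ≥ 0`, `Φ(·, s)` solves
`Φ̇(t, s) = -L(t) Φ(t, s)`, `Φ(s, s) = I`, on `[s, ∞)`. -/
def IsTransitionFlow {n : ℕ} (L : ℝ → Matrix (Fin n) (Fin n) ℝ)
    (Φ : ℝ → ℝ → Matrix (Fin n) (Fin n) ℝ) : Prop :=
  ∀ s, 0 ≤ s →
    Φ s s = 1 ∧ IsCaratheodorySolution (fun t Y => -(L t * Y)) s (fun t => Φ t s)

/-- The set of (column-)stochastic matrices of rank one. -/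
def rankOneStochastic (n : ℕ) : Set (Matrix (Fin n) (Fin n) ℝ) :=
  {A | A ∈ Matrix.colStochastic ℝ (Fin n) ∧ A.rank = 1}

/-- Weak exponential ergodicity: `dist (Φ(t, s), 𝕊₁) ≤ a λ^(t-s)` for all `t ≥ s ≥ 0`, where `𝕊₁`
is the set of rank-one stochastic matrices and the distance is that of the Frobenius norm. -/
def IsWeaklyExponentiallyErgodic {n : ℕ} (Φ : ℝ → ℝ → Matrix (Fin n) (Fin n) ℝ) : Prop :=
  ∃ a : ℝ, 0 < a ∧ ∃ lam : ℝ, 0 < lam ∧ lam < 1 ∧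
    ∀ s t, 0 ≤ s → s ≤ t → Metric.infDist (Φ t s) (rankOneStochastic n) ≤ a * lam ^ (t - s)

end Flow

/-! ### Input-output dynamics and flow trackers -/

/-- An input-output dynamics with agents' state `x ∈ ℝ^{n×d}`, auxiliary state `w ∈ ℝ^N`,
input `u ∈ ℝ^{n×d}` and output `y ∈ ℝ^{n×d}`:
`ẋ = f(t, x, w, u)`, `ẇ = g(t, x, w, u)`, `y = h(t, x, w)`. -/
structure InputOutputDynamics (n d N : ℕ) where
  /-- the velocity of `x` -/
  f : ℝ → State n d → (Fin N → ℝ) → State n d → State n d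
  /-- the velocity of `w` -/
  g : ℝ → State n d → (Fin N → ℝ) → State n d → (Fin N → ℝ)
  /-- the output map -/
  h : ℝ → State n d → (Fin N → ℝ) → State n d

/-- `(x, w)` is a (Carathéodory) trajectory on `[0, ∞)` of the dynamics under the input `u`. -/
def InputOutputDynamics.IsTrajectory {n d N : ℕ} (S : InputOutputDynamics n d N)
    (u x : ℝ → State n d) (w : ℝ → Fin N → ℝ) : Prop :=
  IsCaratheodorySolution
    (fun t (p : State n d × (Fin N → ℝ)) => (S.f t p.1 p.2 (u t), S.g t p.1 p.2 (u t)))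
    0 (fun t => (x t, w t))

/-- Flow tracker with respect to a set `Q` of initial conditions: there are `c > 0` and
`lam ∈ (0,1)` such that along every trajectory starting in `Q`, under any locally integrable
input, the average of the state is driven by the average of the input, and every output
`y i` observes this average up to the error
`c (lam^t ‖x(0)‖ + ∫₀ᵗ lam^(t-τ) ‖u(τ)‖ dτ)`. -/
def InputOutputDynamics.IsFlowTracker {n d N : ℕ} (S : InputOutputDynamics n d N)
    (Q : Set (State n d × (Fin N → ℝ))) : Prop :=
  ∃ c : ℝ, 0 < c ∧ ∃ lam : ℝ, 0 < lam ∧ lam < 1 ∧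
    ∀ (u x : ℝ → State n d) (w : ℝ → Fin N → ℝ),
      (∀ T, 0 ≤ T → IntervalIntegrable u volume 0 T) →
      S.IsTrajectory u x w → (x 0, w 0) ∈ Q →
        IsCaratheodorySolution (fun t _ => average (u t)) 0 (fun t => average (x t)) ∧
        ∀ t, 0 ≤ t → ∀ i,
          ‖S.h t (x t) (w t) i - average (x t)‖ ≤
            c * (lam ^ t * stateNorm (x 0) + ∫ τ in (0 : ℝ)..t, lam ^ (t - τ) * stateNorm (u τ))

/-- The averaging dynamics `ẋ = -L(t) x + u`, `y = x`, without auxiliary state (`N = 0`). -/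
def averagingDynamics {n : ℕ} (d : ℕ) (L : ℝ → Matrix (Fin n) (Fin n) ℝ) :
    InputOutputDynamics n d 0 where
  f t x _ u := -act (L t) x + u
  g _ _ _ _ := 0
  h _ x _ := x

/-! ### The optimization problem and the step size -/

/-- The set `X*` of minimizers of `F = ∑ᵢ fᵢ` over `ℝ^d`. -/
def minimizers {n d : ℕ} (f : Fin n → EuclideanSpace ℝ (Fin d) → ℝ) :
    Set (EuclideanSpace ℝ (Fin d)) :=
  {z | ∀ z', ∑ i, f i z ≤ ∑ i, f i z'}

/-- The gradient of `F̃(x) = ∑ᵢ fᵢ(xᵢ)`, i.e. the `n × d` matrix with rows `∇fᵢ(xᵢ)`. -/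
def stackedGradient {n d : ℕ} (f : Fin n → EuclideanSpace ℝ (Fin d) → ℝ) (x : State n d) :
    State n d :=
  fun i => gradient (f i) (x i)

/-- Standing assumption on the optimization problem: the cost functions are convex and
differentiable, a minimizer of their sum exists, and the gradients grow at most linearly
(as they do when they are bounded, and when they are Lipschitz continuous). -/
structure IsAdmissibleProblem {n d : ℕ} (f : Fin n → EuclideanSpace ℝ (Fin d) → ℝ) : Prop where
  convex : ∀ i, ConvexOn ℝ Set.univ (f i)
  differentiable : ∀ i, Differentiable ℝ (f i)
  nonempty : (minimizers f).Nonempty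
  gradient_growth : ∃ K : ℝ, ∀ i z, ‖gradient (f i) z‖ ≤ K * (1 + ‖z‖)

/-- Step-size assumption: `α` is measurable and nonnegative on `[0, ∞)`, with `∫₀^∞ α = ∞` and
`∫₀^∞ α² < ∞`. -/
structure IsStepSize (α : ℝ → ℝ) : Prop where
  measurable : AEMeasurable α (volume.restrict (Set.Ici 0))
  nonneg : ∀ t, 0 ≤ t → 0 ≤ α t
  integral_eq_top : ∫⁻ t in Set.Ici (0 : ℝ), ENNReal.ofReal (α t) = ⊤
  sq_integral_lt_top : ∫⁻ t in Set.Ici (0 : ℝ), ENNReal.ofReal (α t ^ 2) < ⊤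

end FlowTracker

end

noncomputable section

namespace FlowTracker

/-! ### Indefinite integrals -/

/-! Tracking. Zero column sums make `L x` average-free and zero row sums make `L` blind to
consensus, so the average is driven by the average input and the deviation from it obeys the same
dynamics with centered input. Weight balance makes the quadratic form of `L` nonnegative, so the
driven dynamics is non-expansive up to twice the integral of the input
(`stateNorm_le_add_integral`). Rank-one stochastic matrices annihilate states of zero sum, so
ergodicity makes the flow halve deviations over a window of fixed length, and iterating over windows
yields exponential weights (`le_exp_weighted_of_halving`, `exists_stateNorm_center_le`).

Optimization. The gradient term is an input of size at most a constant times `α (1 + R)`, where `R`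
is the distance of the state to consensus at a reference point `z`. Let `E` be the tracking bound on
the disagreement. Convexity gives `stateNorm_sub_sq_le`: `R²` decreases by twice the integral of `α`
times the optimality gap at the average, up to a multiple of `∫ α (1 + R) E`. Boundedness of `R` is
not known beforehand. But `E` is a multiple of the output of a stable first-order filter, so its
`L²` norm is controlled by that of `α (1 + R)` and by the initial state; for `z` a minimizer,
Young's inequality and Grönwall with kernel `α²` then bound `R` and make the error integral converge
(`exists_integral_mul_le`).

Since `∫ α = ∞`, the gap and `E` become small simultaneously along a sequence of times. A
subsequence of the averages converges to a minimizer, and quasi-Fejér monotonicity relative to that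
minimizer upgrades this to convergence of the whole trajectory (`tendsto_zero_of_quasiFejer`). -/

/-- `x` is, on `[s, ∞)`, an indefinite integral of the locally integrable function `v`. -/
def IsPrimitiveFrom {E : Type*} [NormedAddCommGroup E] [NormedSpace ℝ E]
    (v : ℝ → E) (s : ℝ) (x : ℝ → E) : Prop :=
  ∀ t, s ≤ t → IntervalIntegrable v volume s t ∧ x t = x s + ∫ τ in s..t, v τ

section Primitive

variable {E F : Type*} [NormedAddCommGroup E] [NormedSpace ℝ E]
  [NormedAddCommGroup F] [NormedSpace ℝ F] {s t : ℝ} {v w x y : ℝ → E}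

lemma isCaratheodorySolution_iff {v : ℝ → E → E} :
    IsCaratheodorySolution v s x ↔ IsPrimitiveFrom (fun τ => v τ (x τ)) s x := Iff.rfl

lemma IsPrimitiveFrom.intervalIntegrable (h : IsPrimitiveFrom v s x) {a b : ℝ} (ha : s ≤ a)
    (hb : s ≤ b) : IntervalIntegrable v volume a b :=
  (h a ha).1.symm.trans (h b hb).1

lemma IsPrimitiveFrom.eq_add (h : IsPrimitiveFrom v s x) {a b : ℝ} (ha : s ≤ a) (hb : s ≤ b) :
    x b = x a + ∫ τ in a..b, v τ := by
  rw [(h b hb).2, (h a ha).2, add_assoc,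
    intervalIntegral.integral_add_adjacent_intervals (h a ha).1 (h.intervalIntegrable ha hb)]

lemma IsPrimitiveFrom.restart (h : IsPrimitiveFrom v s x) (hst : s ≤ t) :
    IsPrimitiveFrom v t x := fun _ hr =>
  ⟨h.intervalIntegrable hst (hst.trans hr), h.eq_add hst (hst.trans hr)⟩

lemma IsPrimitiveFrom.congr (h : IsPrimitiveFrom v s x) (hv : ∀ τ, s ≤ τ → v τ = w τ)
    (hx : ∀ τ, s ≤ τ → x τ = y τ) : IsPrimitiveFrom w s y := fun t ht => by
  have hvw : ∀ τ ∈ Set.uIcc s t, v τ = w τ := fun τ hτ => by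
    rw [Set.uIcc_of_le ht] at hτ
    exact hv τ hτ.1
  refine ⟨(h t ht).1.congr fun τ hτ => hvw τ (Set.uIoc_subset_uIcc hτ), ?_⟩
  rw [← hx t ht, ← hx s le_rfl, ← intervalIntegral.integral_congr hvw]
  exact (h t ht).2

lemma IsPrimitiveFrom.add (h : IsPrimitiveFrom v s x) (h' : IsPrimitiveFrom w s y) :
    IsPrimitiveFrom (fun τ => v τ + w τ) s (fun τ => x τ + y τ) := fun t ht => by
  refine ⟨(h t ht).1.add (h' t ht).1, ?_⟩
  beta_reduce
  rw [intervalIntegral.integral_add (h t ht).1 (h' t ht).1, (h t ht).2, (h' t ht).2]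
  abel

lemma IsPrimitiveFrom.sub (h : IsPrimitiveFrom v s x) (h' : IsPrimitiveFrom w s y) :
    IsPrimitiveFrom (fun τ => v τ - w τ) s (fun τ => x τ - y τ) := fun t ht => by
  refine ⟨(h t ht).1.sub (h' t ht).1, ?_⟩
  beta_reduce
  rw [intervalIntegral.integral_sub (h t ht).1 (h' t ht).1, (h t ht).2, (h' t ht).2]
  abel

lemma isPrimitiveFrom_const (c : E) : IsPrimitiveFrom (fun _ => 0) s (fun _ => c) :=
  fun t _ => ⟨IntervalIntegrable.zero, by simp⟩

lemma isPrimitiveFrom_integral (h : ∀ t, s ≤ t → IntervalIntegrable v volume s t) :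
    IsPrimitiveFrom v s (fun t => ∫ τ in s..t, v τ) := fun t ht => ⟨h t ht, by simp⟩

lemma isPrimitiveFrom_of_hasDerivAt [CompleteSpace E] (h : ∀ t, HasDerivAt x (v t) t)
    (hv : Continuous v) : IsPrimitiveFrom v s x := fun t _ =>
  ⟨hv.intervalIntegrable _ _, by
    rw [intervalIntegral.integral_eq_sub_of_hasDerivAt (fun τ _ => h τ)
      (hv.intervalIntegrable _ _)]
    abel⟩

lemma IsPrimitiveFrom.map [CompleteSpace E] [CompleteSpace F] (A : E →L[ℝ] F)
    (h : IsPrimitiveFrom v s x) :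
    IsPrimitiveFrom (fun τ => A (v τ)) s (fun τ => A (x τ)) := fun t ht => by
  refine ⟨⟨A.integrable_comp (h t ht).1.1, A.integrable_comp (h t ht).1.2⟩, ?_⟩
  beta_reduce
  rw [A.intervalIntegral_comp_comm (h t ht).1, (h t ht).2, map_add]

lemma IsPrimitiveFrom.continuousOn (h : IsPrimitiveFrom v s x) :
    ContinuousOn x (Set.Ici s) := by
  have hIcc : ∀ t, s ≤ t → ContinuousOn x (Set.Icc s t) := fun t ht => by
    have h1 := intervalIntegral.continuousOn_primitive_interval (μ := volume) (f := v)
      (a := s) (b := t) (by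
        rw [Set.uIcc_of_le ht]
        exact (intervalIntegrable_iff_integrableOn_Icc_of_le ht).1 (h t ht).1)
    rw [Set.uIcc_of_le ht] at h1
    exact (continuousOn_const.add h1).congr fun τ hτ => (h τ hτ.1).2
  intro t ht
  have hts : s ≤ t := ht
  refine (hIcc (t + 1) (by linarith) t ⟨hts, by linarith⟩).mono_of_mem_nhdsWithin ?_
  rw [← Set.Ici_inter_Iic]
  exact inter_mem self_mem_nhdsWithin (mem_nhdsWithin_of_mem_nhds (Iic_mem_nhds (by linarith)))

lemma continuousOn_uIcc_of_Ici {X : Type*} [TopologicalSpace X] {g : ℝ → X}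
    (h : ContinuousOn g (Set.Ici s)) {a b : ℝ} (ha : s ≤ a) (hb : s ≤ b) :
    ContinuousOn g (Set.uIcc a b) :=
  h.mono fun _ hτ => (le_min ha hb).trans hτ.1

lemma IsPrimitiveFrom.continuousOn_uIcc (h : IsPrimitiveFrom v s x) {a b : ℝ} (ha : s ≤ a)
    (hb : s ≤ b) : ContinuousOn x (Set.uIcc a b) :=
  continuousOn_uIcc_of_Ici h.continuousOn ha hb

end Primitive

/-- The product rule for indefinite integrals. -/
lemma IsPrimitiveFrom.mul {s : ℝ} {f g F G : ℝ → ℝ} (hF : IsPrimitiveFrom f s F)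
    (hG : IsPrimitiveFrom g s G) :
    IsPrimitiveFrom (fun τ => f τ * G τ + F τ * g τ) s (fun τ => F τ * G τ) := fun t ht => by
  refine ⟨((hF t ht).1.mul_continuousOn (hG.continuousOn_uIcc le_rfl ht)).add
    ((hG t ht).1.continuousOn_mul (hF.continuousOn_uIcc le_rfl ht)), ?_⟩
  -- `F` is only known on `[s, ∞)`, so integration by parts is applied to its integral
  -- representation, which is absolutely continuous and defined on all of `ℝ`.
  have key : ∀ {f F : ℝ → ℝ}, IsPrimitiveFrom f s F →
      AbsolutelyContinuousOnInterval (fun r => F s + ∫ τ in s..r, f τ) s t ∧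
      ∀ᵐ r, r ∈ Set.uIcc s t → deriv (fun r => F s + ∫ τ in s..r, f τ) r = f r := by
    intro f F hF
    constructor
    · have h1 := (hF t ht).1.absolutelyContinuousOnInterval_intervalIntegral
        (c := s) Set.left_mem_uIcc
      have h2 : AbsolutelyContinuousOnInterval (fun _ : ℝ => F s) s t :=
        (LipschitzWith.const (F s)).lipschitzOnWith.absolutelyContinuousOnInterval
      exact h2.add h1
    · filter_upwards [(hF t ht).1.ae_hasDerivAt_integral] with r hr hrs
      exact ((hr hrs s Set.left_mem_uIcc).const_add _).deriv
  obtain ⟨hF1, hF2⟩ := key hF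
  obtain ⟨hG1, hG2⟩ := key hG
  have h := hF1.integral_deriv_mul_eq_sub hG1
  rw [← (hF t ht).2, ← (hG t ht).2] at h
  simp only [intervalIntegral.integral_same, add_zero] at h
  rw [← sub_eq_iff_eq_add', ← h]
  refine intervalIntegral.integral_congr_ae ?_
  filter_upwards [hF2, hG2] with r h1 h2 hr
  have hr' := Set.uIoc_subset_uIcc hr
  have hsr : s ≤ r := by rw [Set.uIcc_of_le ht] at hr'; exact hr'.1
  rw [h1 hr', h2 hr', ← (hF r hsr).2, ← (hG r hsr).2]

/-- The energy identity `‖x‖²˙ = 2 ⟪x, ẋ⟫`. -/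
lemma IsPrimitiveFrom.norm_sq {H : Type*} [NormedAddCommGroup H] [InnerProductSpace ℝ H]
    [FiniteDimensional ℝ H] {s : ℝ} {v x : ℝ → H} (h : IsPrimitiveFrom v s x) :
    IsPrimitiveFrom (fun τ => 2 * inner ℝ (x τ) (v τ)) s (fun τ => ‖x τ‖ ^ 2) := by
  have : CompleteSpace H := FiniteDimensional.complete ℝ H
  -- Coordinates in an orthonormal basis reduce the identity to the scalar product rule.
  let b := stdOrthonormalBasis ℝ H
  have hc : ∀ i, IsPrimitiveFrom (fun τ => inner ℝ (b i) (v τ)) s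
      (fun τ => inner ℝ (b i) (x τ)) := fun i => h.map (innerSL ℝ (b i))
  have hsum : ∀ S : Finset _, IsPrimitiveFrom
      (fun τ => ∑ i ∈ S, (inner ℝ (b i) (v τ) * inner ℝ (b i) (x τ)
        + inner ℝ (b i) (x τ) * inner ℝ (b i) (v τ))) s
      (fun τ => ∑ i ∈ S, inner ℝ (b i) (x τ) * inner ℝ (b i) (x τ)) := by
    classical
    intro S
    induction S using Finset.induction_on with
    | empty => simpa using isPrimitiveFrom_const (0 : ℝ)
    | insert i S hi ih =>
      simp only [Finset.sum_insert hi]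
      exact ((hc i).mul (hc i)).add ih
  refine (hsum Finset.univ).congr (fun τ _ => ?_) (fun τ _ => ?_)
  · rw [Finset.sum_add_distrib, two_mul]
    congr 1
    · rw [← b.sum_inner_mul_inner]
      exact Finset.sum_congr rfl fun i _ => by rw [mul_comm, real_inner_comm (x τ)]
    · rw [← b.sum_inner_mul_inner]
      exact Finset.sum_congr rfl fun i _ => by rw [real_inner_comm (x τ)]
  · rw [← real_inner_self_eq_norm_sq, ← b.sum_inner_mul_inner]
    exact Finset.sum_congr rfl fun i _ => by rw [real_inner_comm (x τ)]

/-! ### Algebra of stacked states -/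

section Algebra

variable {n d : ℕ}

/-- `State` carries the sup norm of a Pi type; the Hilbert structure behind `stateNorm` is reached
through `WithLp 2`. -/
lemma stateNorm_eq_norm_toLp (x : State n d) : stateNorm x = ‖WithLp.toLp 2 x‖ :=
  (PiLp.norm_eq_of_L2 _).symm

lemma stateNorm_nonneg (x : State n d) : 0 ≤ stateNorm x := Real.sqrt_nonneg _

lemma stateNorm_sq (x : State n d) : stateNorm x ^ 2 = ∑ i, ‖x i‖ ^ 2 :=
  Real.sq_sqrt (Finset.sum_nonneg fun _ _ => by positivity)

lemma stateNorm_add_le (x y : State n d) : stateNorm (x + y) ≤ stateNorm x + stateNorm y := by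
  simp only [stateNorm_eq_norm_toLp, WithLp.toLp_add]
  exact norm_add_le _ _

lemma stateNorm_zero : stateNorm (0 : State n d) = 0 := by
  simp [stateNorm_eq_norm_toLp]

lemma norm_apply_le_stateNorm (x : State n d) (i : Fin n) : ‖x i‖ ≤ stateNorm x := by
  rw [stateNorm_eq_norm_toLp]
  exact PiLp.norm_apply_le (WithLp.toLp 2 x) i

lemma stateNorm_le_sum (x : State n d) : stateNorm x ≤ ∑ i, ‖x i‖ := by
  refine Real.sqrt_le_iff.2 ⟨Finset.sum_nonneg fun _ _ => norm_nonneg _, ?_⟩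
  exact Finset.sum_sq_le_sq_sum_of_nonneg fun _ _ => norm_nonneg _

lemma sum_inner_le_stateNorm_mul (x y : State n d) :
    ∑ i, inner ℝ (x i) (y i) ≤ stateNorm x * stateNorm y := by
  have h := real_inner_le_norm (WithLp.toLp 2 x) (WithLp.toLp 2 y)
  rwa [PiLp.inner_apply, ← stateNorm_eq_norm_toLp, ← stateNorm_eq_norm_toLp] at h

lemma continuous_stateNorm : Continuous (stateNorm : State n d → ℝ) := by
  unfold stateNorm
  fun_prop

/-- The average as a continuous linear map. -/
def averageCLM (n d : ℕ) : State n d →L[ℝ] EuclideanSpace ℝ (Fin d) :=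
  (n : ℝ)⁻¹ • ∑ i, ContinuousLinearMap.proj i

lemma averageCLM_apply (x : State n d) : averageCLM n d x = average x := by
  simp [averageCLM, average]

/-- The deviation of the rows from their average. -/
def center (x : State n d) : State n d := fun i => x i - average x

/-- The deviation from the average as a continuous linear map. -/
def centerCLM (n d : ℕ) : State n d →L[ℝ] State n d :=
  ContinuousLinearMap.pi fun i => ContinuousLinearMap.proj i - averageCLM n d

lemma centerCLM_apply (x : State n d) : centerCLM n d x = center x := by
  funext i
  simp [centerCLM, averageCLM_apply, center]

lemma sum_eq_smul_average (x : State n d) : ∑ i, x i = (n : ℝ) • average x := by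
  rcases Nat.eq_zero_or_pos n with rfl | hn
  · simp
  · rw [average, smul_inv_smul₀ (by positivity)]

lemma sum_center (x : State n d) : ∑ i, center x i = 0 := by
  simp only [center, Finset.sum_sub_distrib, sum_eq_smul_average, Finset.sum_const,
    Finset.card_univ, Fintype.card_fin, ← Nat.cast_smul_eq_nsmul ℝ, sub_self]

/-- Centering is an orthogonal projection: it removes exactly `n ‖average x‖²` from the squared
norm. -/
lemma stateNorm_center_le (x : State n d) : stateNorm (center x) ≤ stateNorm x := by
  refine Real.sqrt_le_sqrt ?_
  have h : ∑ i, ‖center x i‖ ^ 2 = ∑ i, ‖x i‖ ^ 2 - n * ‖average x‖ ^ 2 := by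
    have h1 : ∑ i, inner ℝ (x i) (average x) = n * ‖average x‖ ^ 2 := by
      rw [← sum_inner, sum_eq_smul_average, real_inner_smul_left, real_inner_self_eq_norm_sq]
    simp only [center, norm_sub_sq_real, Finset.sum_add_distrib, Finset.sum_sub_distrib,
      ← Finset.mul_sum, h1, Finset.sum_const, Finset.card_univ, Fintype.card_fin, nsmul_eq_mul]
    ring
  rw [h]
  have : 0 ≤ (n : ℝ) * ‖average x‖ ^ 2 := by positivity
  linarith

lemma act_sub (A : Matrix (Fin n) (Fin n) ℝ) (x y : State n d) :
    act A (x - y) = act A x - act A y := by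
  funext i
  simp [act, smul_sub]

lemma sub_act (A B : Matrix (Fin n) (Fin n) ℝ) (x : State n d) :
    act (A - B) x = act A x - act B x := by
  funext i
  simp [act, sub_smul]

lemma neg_act (A : Matrix (Fin n) (Fin n) ℝ) (x : State n d) : act (-A) x = -act A x := by
  funext i
  simp [act]

lemma one_act (x : State n d) : act (1 : Matrix (Fin n) (Fin n) ℝ) x = x := by
  funext i
  simp [act, Matrix.one_apply]

lemma mul_act (A B : Matrix (Fin n) (Fin n) ℝ) (x : State n d) :
    act (A * B) x = act A (act B x) := by
  funext i
  simp only [act, Matrix.mul_apply, Finset.sum_smul, Finset.smul_sum, mul_smul]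
  rw [Finset.sum_comm]

lemma IsWeightBalanced.act_const {A : Matrix (Fin n) (Fin n) ℝ} (hA : IsWeightBalanced A)
    (c : EuclideanSpace ℝ (Fin d)) : act A (fun _ => c) = 0 := by
  funext i
  have h := hA.2.2 i
  simp only [Matrix.transpose_apply] at h
  simp [act, ← Finset.sum_smul, h]

lemma IsWeightBalanced.average_act {A : Matrix (Fin n) (Fin n) ℝ} (hA : IsWeightBalanced A)
    (x : State n d) : average (act A x) = 0 := by
  simp only [average, act]
  rw [Finset.sum_comm]
  simp [← Finset.sum_smul, hA.1.2]

lemma IsWeightBalanced.act_center {A : Matrix (Fin n) (Fin n) ℝ} (hA : IsWeightBalanced A)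
    (x : State n d) : act A (center x) = act A x := by
  have h : center x = x - fun _ => average x := rfl
  rw [h, act_sub, hA.act_const, sub_zero]

/-- Vanishing row and column sums turn the quadratic form into `-1/2 ∑ A i j ‖x i - x j‖²`, where
only the nonpositive off-diagonal entries count. -/
lemma IsWeightBalanced.sum_inner_act_nonneg {A : Matrix (Fin n) (Fin n) ℝ}
    (hA : IsWeightBalanced A) (x : State n d) : 0 ≤ ∑ i, inner ℝ (x i) (act A x i) := by
  have hrow : ∑ i, ∑ j, A i j * ‖x i‖ ^ 2 = 0 :=
    Finset.sum_eq_zero fun i _ => by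
      rw [← Finset.sum_mul, show ∑ j, A i j = 0 from hA.2.2 i, zero_mul]
  have hcol : ∑ i, ∑ j, A i j * ‖x j‖ ^ 2 = 0 := by
    rw [Finset.sum_comm]
    exact Finset.sum_eq_zero fun j _ => by rw [← Finset.sum_mul, hA.1.2 j, zero_mul]
  have hdiff : ∑ i, ∑ j, A i j * ‖x i - x j‖ ^ 2 ≤ 0 :=
    Finset.sum_nonpos fun i _ => Finset.sum_nonpos fun j _ => by
      rcases eq_or_ne i j with rfl | hij
      · simp
      · exact mul_nonpos_of_nonpos_of_nonneg (hA.1.1 i j hij) (by positivity)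
  have hexp : ∑ i, ∑ j, A i j * ‖x i - x j‖ ^ 2 = ∑ i, ∑ j, A i j * ‖x i‖ ^ 2
      - 2 * ∑ i, inner ℝ (x i) (act A x i) + ∑ i, ∑ j, A i j * ‖x j‖ ^ 2 := by
    simp only [act, inner_sum, Finset.mul_sum, ← Finset.sum_sub_distrib,
      ← Finset.sum_add_distrib]
    refine Finset.sum_congr rfl fun i _ => Finset.sum_congr rfl fun j _ => ?_
    rw [norm_sub_sq_real, real_inner_smul_right]
    ring
  linarith

end Algebra

/-! ### Rank-one stochastic matrices -/

section RankOne

variable {n d : ℕ}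

/-- Rank one makes the columns multiples of a single vector, and unit column sums force these
multiples to coincide. So `A x` depends only on the sum of the rows of `x`. -/
lemma act_eq_zero_of_mem_rankOneStochastic {A : Matrix (Fin n) (Fin n) ℝ}
    (hA : A ∈ rankOneStochastic n) {x : State n d} (hx : ∑ i, x i = 0) : act A x = 0 := by
  obtain ⟨hst, hrank⟩ := hA
  have hcol := (Matrix.mem_colStochastic_iff_sum.1 hst).2
  obtain ⟨w, -, hw⟩ := finrank_eq_one_iff'.1 hrank
  have hc : ∀ j, ∃ c : ℝ, ∀ i, A i j = c * (w : Fin n → ℝ) i := fun j => by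
    obtain ⟨c, hc⟩ := hw ⟨A.mulVecLin (Pi.single j 1), LinearMap.mem_range_self _ _⟩
    refine ⟨c, fun i => ?_⟩
    have := congrFun (congrArg Subtype.val hc) i
    simpa using this.symm
  choose c hc using hc
  have hcs : ∀ j, c j * ∑ i, (w : Fin n → ℝ) i = 1 := fun j => by
    rw [Finset.mul_sum, ← hcol j]
    exact Finset.sum_congr rfl fun i _ => (hc j i).symm
  have hconst : ∀ i j k, A i j = A i k := fun i j k => by
    have hne : ∑ i, (w : Fin n → ℝ) i ≠ 0 := fun h => by simpa [h] using hcs j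
    rw [hc, hc, mul_right_cancel₀ hne ((hcs j).trans (hcs k).symm)]
  funext i
  have : act A x i = A i i • ∑ j, x j := by
    rw [Finset.smul_sum]
    exact Finset.sum_congr rfl fun j _ => by rw [hconst i j i]
  rw [this, hx, smul_zero, Pi.zero_apply]

/-- Needed because `Metric.infDist` to the empty set is `0`, which would carry no information. -/
lemma rankOneStochastic_nonempty (hn : 0 < n) : (rankOneStochastic n).Nonempty := by
  have hn' : (n : ℝ) ≠ 0 := by positivity
  refine ⟨Matrix.of fun _ _ => (n : ℝ)⁻¹, ?_, ?_⟩
  · refine Matrix.mem_colStochastic_iff_sum.2 ⟨fun _ _ => ?_, fun _ => ?_⟩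
    · simp
    · simp [hn']
  · have h : LinearMap.range (Matrix.of fun _ _ : Fin n => (n : ℝ)⁻¹).mulVecLin
        = Submodule.span ℝ {fun _ : Fin n => (1 : ℝ)} := by
      refine le_antisymm ?_ ?_
      · rintro _ ⟨v, rfl⟩
        refine Submodule.mem_span_singleton.2 ⟨(n : ℝ)⁻¹ * ∑ i, v i, ?_⟩
        funext i
        simp [Matrix.mulVec, dotProduct, Finset.mul_sum]
      · rw [Submodule.span_singleton_le_iff_mem]
        exact ⟨fun _ => 1, by funext i; simp [Matrix.mulVec, dotProduct, hn']⟩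
    rw [Matrix.rank, h]
    exact finrank_span_singleton fun h0 => one_ne_zero (congrFun h0 ⟨0, hn⟩)

open scoped Matrix.Norms.Frobenius

lemma stateNorm_act_le (A : Matrix (Fin n) (Fin n) ℝ) (x : State n d) :
    stateNorm (act A x) ≤ ‖A‖ * stateNorm x := by
  have hA : ‖A‖ = Real.sqrt (∑ i, ∑ j, |A i j| ^ 2) := by
    rw [Matrix.frobenius_norm_def, Real.sqrt_eq_rpow]
    simp
  rw [hA, stateNorm, stateNorm, ← Real.sqrt_mul (by positivity), Finset.sum_mul]
  refine Real.sqrt_le_sqrt (Finset.sum_le_sum fun i _ => ?_)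
  calc ‖act A x i‖ ^ 2 ≤ (∑ j, |A i j| * ‖x j‖) ^ 2 := by
        gcongr
        exact (norm_sum_le _ _).trans (Finset.sum_le_sum fun j _ => by
          rw [norm_smul, Real.norm_eq_abs])
    _ ≤ _ := Finset.sum_mul_sq_le_sq_mul_sq _ _ _

/-- Every rank-one stochastic `B` kills `x`, so `A` may be replaced by `A - B`; approximating the
infimum over `B` gives the bound without a minimizer. -/
lemma stateNorm_act_le_infDist (hn : 0 < n) (A : Matrix (Fin n) (Fin n) ℝ) {x : State n d}
    (hx : ∑ i, x i = 0) :
    stateNorm (act A x) ≤ Metric.infDist A (rankOneStochastic n) * stateNorm x := by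
  rcases (stateNorm_nonneg x).eq_or_lt with h0 | hpos
  · simpa [← h0] using stateNorm_act_le A x
  rw [← div_le_iff₀ hpos]
  refine le_of_forall_gt_imp_ge_of_dense fun r hr => ?_
  obtain ⟨B, hB, hAB⟩ := (Metric.infDist_lt_iff (rankOneStochastic_nonempty hn)).1 hr
  rw [div_le_iff₀ hpos]
  have h : act A x = act (A - B) x := by
    rw [sub_act, act_eq_zero_of_mem_rankOneStochastic hB hx, sub_zero]
  rw [h]
  refine (stateNorm_act_le _ _).trans ?_
  rw [dist_eq_norm] at hAB
  gcongr

end RankOne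

/-! ### Contraction and exponential agreement -/

section Agreement

variable {n d : ℕ}

lemma intervalIntegrable_stateNorm {u : ℝ → State n d} {a b : ℝ}
    (h : IntervalIntegrable u volume a b) :
    IntervalIntegrable (fun τ => stateNorm (u τ)) volume a b := by
  have h' : IntervalIntegrable (fun τ => (WithLp.toLp 2 (u τ) :
      PiLp 2 fun _ : Fin n => EuclideanSpace ℝ (Fin d))) volume a b :=
    ⟨(PiLp.continuousLinearEquiv 2 ℝ (fun _ : Fin n => EuclideanSpace ℝ (Fin d))).symm
      |>.toContinuousLinearMap.integrable_comp h.1,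
     (PiLp.continuousLinearEquiv 2 ℝ (fun _ : Fin n => EuclideanSpace ℝ (Fin d))).symm
      |>.toContinuousLinearMap.integrable_comp h.2⟩
  simpa only [stateNorm_eq_norm_toLp] using h'.norm

lemma IsPrimitiveFrom.stateNorm_sq {s : ℝ} {v x : ℝ → State n d} (h : IsPrimitiveFrom v s x) :
    IsPrimitiveFrom (fun τ => 2 * ∑ i, inner ℝ (x τ i) (v τ i)) s
      (fun τ => stateNorm (x τ) ^ 2) := by
  have h' := (h.map (PiLp.continuousLinearEquiv 2 ℝ
    (fun _ : Fin n => EuclideanSpace ℝ (Fin d))).symm.toContinuousLinearMap).norm_sq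
  refine h'.congr (fun τ _ => ?_) (fun τ _ => ?_)
  · rw [PiLp.inner_apply]
    rfl
  · rw [stateNorm_eq_norm_toLp]
    rfl

variable {L : ℝ → Matrix (Fin n) (Fin n) ℝ} {s t : ℝ} {x v : ℝ → State n d}

/-- Perturbed averaging dynamics are non-expansive up to the size of the perturbation. -/
lemma stateNorm_le_add_integral (hL : ∀ τ, s ≤ τ → IsWeightBalanced (L τ))
    (hx : IsPrimitiveFrom (fun τ => -act (L τ) (x τ) + v τ) s x)
    (hv : ∀ τ, s ≤ τ → IntervalIntegrable v volume s τ) (hst : s ≤ t) :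
    stateNorm (x t) ≤ stateNorm (x s) + 2 * ∫ τ in s..t, stateNorm (v τ) := by
  have hcont : ContinuousOn (fun τ => stateNorm (x τ)) (Set.Ici s) :=
    continuous_stateNorm.comp_continuousOn hx.continuousOn
  -- At a maximum of the norm over `[s, t]`, the energy estimate is divisible by that maximum. This
  -- avoids differentiating the norm at zero and is where the factor `2` comes from.
  obtain ⟨r, ⟨hsr, hrt⟩, hmax⟩ := isCompact_Icc.exists_isMaxOn ⟨t, hst, le_rfl⟩
    (hcont.mono (Set.Icc_subset_Ici_self : Set.Icc s t ⊆ _))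
  have hmax : ∀ τ ∈ Set.Icc s t, stateNorm (x τ) ≤ stateNorm (x r) := hmax
  have hvn := fun τ hτ => intervalIntegrable_stateNorm (hv τ hτ)
  have hB : ∫ τ in s..r, stateNorm (v τ) ≤ ∫ τ in s..t, stateNorm (v τ) :=
    intervalIntegral.integral_mono_interval le_rfl hsr hrt
      (Eventually.of_forall fun τ => stateNorm_nonneg _) (hvn t hst)
  have hE : ∫ τ in s..r, 2 * ∑ i, inner ℝ (x τ i) ((-act (L τ) (x τ) + v τ) i)
      ≤ ∫ τ in s..r, 2 * stateNorm (x r) * stateNorm (v τ) := by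
    refine intervalIntegral.integral_mono_on hsr (hx.stateNorm_sq r hsr).1
      ((hvn r hsr).const_mul _) fun τ hτ => ?_
    have h1 := (hL τ hτ.1).sum_inner_act_nonneg (x τ)
    have h2 := sum_inner_le_stateNorm_mul (x τ) (v τ)
    have h3 := mul_le_mul_of_nonneg_right (hmax τ ⟨hτ.1, hτ.2.trans hrt⟩)
      (stateNorm_nonneg (v τ))
    simp only [Pi.add_apply, Pi.neg_apply, inner_add_right, inner_neg_right,
      Finset.sum_add_distrib, Finset.sum_neg_distrib]
    linarith
  rw [intervalIntegral.integral_const_mul (2 * stateNorm (x r))] at hE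
  have hsq := (hx.stateNorm_sq r hsr).2
  have hr0 := stateNorm_nonneg (x r)
  have hmul := mul_le_mul_of_nonneg_left hB hr0
  have hs := mul_le_mul_of_nonneg_left (hmax s ⟨le_rfl, hst⟩) (stateNorm_nonneg (x s))
  have key : stateNorm (x r) * stateNorm (x r) ≤
      stateNorm (x r) * (stateNorm (x s) + 2 * ∫ τ in s..t, stateNorm (v τ)) := by
    beta_reduce at hsq
    nlinarith
  have ht := hmax t ⟨hst, le_rfl⟩
  rcases hr0.eq_or_lt with h0 | hpos
  · have : 0 ≤ ∫ τ in s..t, stateNorm (v τ) :=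
      intervalIntegral.integral_nonneg hst fun _ _ => stateNorm_nonneg _
    linarith [stateNorm_nonneg (x s)]
  · exact ht.trans (le_of_mul_le_mul_left key hpos)

section Flow

open scoped Matrix.Norms.Frobenius

/-- The action on a fixed state as a continuous linear map of the matrix. -/
def actCLM (z : State n d) : Matrix (Fin n) (Fin n) ℝ →L[ℝ] State n d :=
  LinearMap.toContinuousLinearMap
    { toFun := fun A => act A z
      map_add' := fun A B => by funext i; simp [act, add_smul, Finset.sum_add_distrib]
      map_smul' := fun c A => by funext i; simp [act, mul_smul, Finset.smul_sum] }

/-- Over any window, the perturbed dynamics differ from the transition flow at most by the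
size of the perturbation. -/
lemma stateNorm_le_infDist_mul_add_integral (hn : 0 < n)
    (hL : ∀ τ, 0 ≤ τ → IsWeightBalanced (L τ))
    {Φ : ℝ → ℝ → Matrix (Fin n) (Fin n) ℝ} (hΦ : IsTransitionFlow L Φ)
    (hx : IsPrimitiveFrom (fun τ => -act (L τ) (x τ) + v τ) s x)
    (hv : ∀ τ, s ≤ τ → IntervalIntegrable v volume s τ)
    (hs : 0 ≤ s) (hst : s ≤ t) (hsum : ∑ i, x s i = 0) :
    stateNorm (x t) ≤ Metric.infDist (Φ t s) (rankOneStochastic n) * stateNorm (x s)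
      + 2 * ∫ τ in s..t, stateNorm (v τ) := by
  obtain ⟨hΦ1, hΦ2⟩ := hΦ s hs
  have : CompleteSpace (Matrix (Fin n) (Fin n) ℝ) := FiniteDimensional.complete ℝ _
  have h1 := (isCaratheodorySolution_iff.1 hΦ2).map (actCLM (x s))
  -- The difference from the unforced flow solves the same forced equation with zero initial state.
  have h2 : IsPrimitiveFrom (fun τ => -act (L τ) (x τ - act (Φ τ s) (x s)) + v τ) s
      (fun τ => x τ - act (Φ τ s) (x s)) := by
    refine (hx.sub h1).congr (fun τ _ => ?_) (fun τ _ => rfl)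
    change -act (L τ) (x τ) + v τ - act (-(L τ * Φ τ s)) (x s) = _
    rw [neg_act, mul_act, act_sub]
    abel
  have h3 := stateNorm_le_add_integral (fun τ hτ => hL τ (hs.trans hτ)) h2 hv hst
  beta_reduce at h3
  rw [hΦ1, one_act, sub_self, stateNorm_zero, zero_add] at h3
  have h4 := stateNorm_act_le_infDist hn (Φ t s) hsum
  have h5 := stateNorm_add_le (x t - act (Φ t s) (x s)) (act (Φ t s) (x s))
  rw [sub_add_cancel] at h5
  linarith

end Flow

/-- If `N` grows at most by `2 ∫ β` and halves over each window of length `h` up to that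
error, then it is bounded by an exponentially weighted integral of `β`. -/
lemma le_exp_weighted_of_halving {N β : ℝ → ℝ} {h : ℝ} (hh : 0 < h)
    (hβ : ∀ t, 0 ≤ t → IntervalIntegrable β volume 0 t) (hβ0 : ∀ t, 0 ≤ β t)
    (hN0 : ∀ t, 0 ≤ N t)
    (hgrow : ∀ t, 0 ≤ t → N t ≤ N 0 + 2 * ∫ τ in (0 : ℝ)..t, β τ)
    (hhalf : ∀ t, 0 ≤ t → N (t + h) ≤ 1 / 2 * N t + 2 * ∫ τ in t..(t + h), β τ)
    {t : ℝ} (ht : 0 ≤ t) :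
    N t ≤ 4 * (((1 / 2 : ℝ) ^ (1 / h)) ^ t * N 0
      + ∫ τ in (0 : ℝ)..t, ((1 / 2 : ℝ) ^ (1 / h)) ^ (t - τ) * β τ) := by
  -- This rate satisfies `μ ^ h = 1 / 2`: weights stay at least `1 / 2` within one window, which
  -- turns the factor `2` into `4`, and in the induction going back by `h` doubles them, cancelling
  -- the halving.
  set μ : ℝ := (1 / 2 : ℝ) ^ (1 / h) with hμ
  have hμ0 : 0 < μ := by positivity
  have hμ1 : μ ≤ 1 := Real.rpow_le_one (by norm_num) (by norm_num) (by positivity)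
  have hμh : μ ^ h = 1 / 2 := by
    rw [hμ, ← Real.rpow_mul (by norm_num), one_div_mul_cancel hh.ne', Real.rpow_one]
  have hanti : ∀ r, r ≤ h → 1 / 2 ≤ μ ^ r := fun r hr => by
    rw [← hμh]
    exact Real.rpow_le_rpow_of_exponent_ge hμ0 hμ1 hr
  have hcont : ∀ t, Continuous fun τ : ℝ => μ ^ (t - τ) := fun t =>
    Continuous.rpow continuous_const (by fun_prop) fun _ => Or.inl hμ0.ne'
  have hII : ∀ t a b, 0 ≤ a → 0 ≤ b →
      IntervalIntegrable (fun τ => μ ^ (t - τ) * β τ) volume a b := fun t a b ha hb =>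
    ((hβ a ha).symm.trans (hβ b hb)).continuousOn_mul (hcont t).continuousOn
  have hwin : ∀ a t, 0 ≤ a → a ≤ t → t ≤ a + h →
      2 * ∫ τ in a..t, β τ ≤ 4 * ∫ τ in a..t, μ ^ (t - τ) * β τ := by
    intro a t ha hat hth
    rw [← intervalIntegral.integral_const_mul, ← intervalIntegral.integral_const_mul]
    refine intervalIntegral.integral_mono_on hat
      (((hβ a ha).symm.trans (hβ t (ha.trans hat))).const_mul _)
      ((hII t a t ha (ha.trans hat)).const_mul _) fun τ hτ => ?_
    have := mul_le_mul_of_nonneg_right (hanti (t - τ) (by linarith [hτ.1])) (hβ0 τ)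
    linarith
  have key : ∀ k : ℕ, ∀ t, 0 ≤ t → t ≤ (k + 1) * h →
      N t ≤ 4 * (μ ^ t * N 0 + ∫ τ in (0 : ℝ)..t, μ ^ (t - τ) * β τ) := by
    intro k
    induction k with
    | zero =>
      intro t ht hth
      have hth : t ≤ h := by simpa using hth
      have h1 := hwin 0 t le_rfl ht (by linarith)
      have h2 := mul_le_mul_of_nonneg_right (hanti t hth) (hN0 0)
      linarith [hgrow t ht, hN0 0]
    | succ k ih =>
      intro t ht hth
      rcases le_total t h with hle | hle
      · have h1 := hwin 0 t le_rfl ht (by linarith)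
        have h2 := mul_le_mul_of_nonneg_right (hanti t hle) (hN0 0)
        linarith [hgrow t ht, hN0 0]
      · have ht' : 0 ≤ t - h := by linarith
        have h1 := ih (t - h) ht' (by push_cast at hth; linarith)
        have h2 := hhalf (t - h) ht'
        have h3 := hwin (t - h) t ht' (by linarith) (by linarith)
        have hsplit := intervalIntegral.integral_add_adjacent_intervals
          (hII t 0 (t - h) le_rfl ht') (hII t (t - h) t ht' ht)
        have hpow : ∀ r : ℝ, μ ^ (r - h) = 2 * μ ^ r := fun r => by
          rw [Real.rpow_sub hμ0, hμh]
          ring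
        have hint : ∫ τ in (0 : ℝ)..(t - h), μ ^ (t - h - τ) * β τ
            = 2 * ∫ τ in (0 : ℝ)..(t - h), μ ^ (t - τ) * β τ := by
          rw [← intervalIntegral.integral_const_mul]
          refine intervalIntegral.integral_congr fun τ _ => ?_
          rw [show t - h - τ = t - τ - h by ring, hpow]
          ring
        rw [hint, hpow] at h1
        rw [sub_add_cancel] at h2
        linarith
  obtain ⟨k, hk⟩ := exists_nat_ge (t / h)
  refine key k t ht ?_
  rw [div_le_iff₀ hh] at hk
  linarith

end Agreement

/-! ### Tracking of the average under arbitrary inputs -/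

section Tracking

variable {n d : ℕ} {L : ℝ → Matrix (Fin n) (Fin n) ℝ}

/-- Centering commutes with the dynamics: `L` does not see the average of its argument, and its
values have zero average. -/
lemma isPrimitiveFrom_center {u x : ℝ → State n d} (hL : ∀ τ, 0 ≤ τ → IsWeightBalanced (L τ))
    (hx : IsPrimitiveFrom (fun τ => -act (L τ) (x τ) + u τ) 0 x) :
    IsPrimitiveFrom (fun τ => -act (L τ) (center (x τ)) + center (u τ)) 0
      (fun τ => center (x τ)) := by
  refine (hx.map (centerCLM n d)).congr (fun τ hτ => ?_) (fun τ _ => centerCLM_apply _)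
  rw [map_add, map_neg, centerCLM_apply, centerCLM_apply, (hL τ hτ).act_center]
  congr 2
  funext i
  rw [center, (hL τ hτ).average_act, sub_zero]

lemma isPrimitiveFrom_average {u x : ℝ → State n d}
    (hL : ∀ τ, 0 ≤ τ → IsWeightBalanced (L τ))
    (hx : IsPrimitiveFrom (fun τ => -act (L τ) (x τ) + u τ) 0 x) :
    IsPrimitiveFrom (fun τ => average (u τ)) 0 (fun τ => average (x τ)) := by
  refine (hx.map (averageCLM n d)).congr (fun τ hτ => ?_) (fun τ _ => averageCLM_apply _)
  rw [map_add, map_neg, averageCLM_apply, averageCLM_apply, (hL τ hτ).average_act, neg_zero,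
    zero_add]

/-- The agents agree up to an exponentially weighted integral of the input. -/
lemma exists_stateNorm_center_le (hn : 0 < n) (hL : ∀ τ, 0 ≤ τ → IsWeightBalanced (L τ))
    {Φ : ℝ → ℝ → Matrix (Fin n) (Fin n) ℝ} (hΦ : IsTransitionFlow L Φ)
    (hΦe : IsWeaklyExponentiallyErgodic Φ) :
    ∃ lam : ℝ, 0 < lam ∧ lam < 1 ∧ ∀ u x : ℝ → State n d,
      (∀ T, 0 ≤ T → IntervalIntegrable u volume 0 T) →
      IsPrimitiveFrom (fun τ => -act (L τ) (x τ) + u τ) 0 x → ∀ t, 0 ≤ t →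
      stateNorm (center (x t)) ≤ 4 * (lam ^ t * stateNorm (x 0)
        + ∫ τ in (0 : ℝ)..t, lam ^ (t - τ) * stateNorm (u τ)) := by
  obtain ⟨a, ha, l, hl0, hl1, herg⟩ := hΦe
  obtain ⟨h, hh, hah⟩ : ∃ h : ℝ, 0 < h ∧ a * l ^ h ≤ 1 / 2 := by
    have ht : Tendsto (fun h : ℝ => a * l ^ h) atTop (𝓝 0) := by
      simpa using (tendsto_rpow_atTop_of_base_lt_one l (by linarith) hl1).const_mul a
    obtain ⟨h, h1, h2⟩ := ((ht.eventually (gt_mem_nhds (show (0 : ℝ) < 1 / 2 by norm_num))).and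
      (eventually_gt_atTop 0)).exists
    exact ⟨h, h2, h1.le⟩
  refine ⟨(1 / 2 : ℝ) ^ (1 / h), by positivity,
    Real.rpow_lt_one (by norm_num) (by norm_num) (by positivity), fun u x hu hx t ht => ?_⟩
  have hc := isPrimitiveFrom_center hL hx
  have hcu : ∀ s, 0 ≤ s → ∀ τ, s ≤ τ →
      IntervalIntegrable (fun r => center (u r)) volume s τ := by
    intro s hs τ hτ
    have h1 := ((hu s hs).symm.trans (hu τ (hs.trans hτ)))
    have h2 : IntervalIntegrable (fun r => centerCLM n d (u r)) volume s τ :=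
      ⟨(centerCLM n d).integrable_comp h1.1, (centerCLM n d).integrable_comp h1.2⟩
    simpa only [centerCLM_apply] using h2
  have hβ : ∀ t, 0 ≤ t → IntervalIntegrable (fun τ => stateNorm (u τ)) volume 0 t :=
    fun t ht => intervalIntegrable_stateNorm (hu t ht)
  have hcle : ∀ s t, 0 ≤ s → s ≤ t →
      ∫ τ in s..t, stateNorm (center (u τ)) ≤ ∫ τ in s..t, stateNorm (u τ) := fun s t hs hst =>
    intervalIntegral.integral_mono_on hst (intervalIntegrable_stateNorm (hcu s hs t hst))
      ((hβ s hs).symm.trans (hβ t (hs.trans hst))) fun τ _ => stateNorm_center_le _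
  have key := le_exp_weighted_of_halving (N := fun t => stateNorm (center (x t))) hh hβ
    (fun _ => stateNorm_nonneg _) (fun _ => stateNorm_nonneg _)
    (fun t ht => by
      have := stateNorm_le_add_integral hL hc (hcu 0 le_rfl) ht
      linarith [hcle 0 t le_rfl ht])
    (fun t ht => by
      have h1 := stateNorm_le_infDist_mul_add_integral hn hL hΦ (hc.restart ht) (hcu t ht) ht
        (show t ≤ t + h by linarith) (sum_center (x t))
      have h2 := herg t (t + h) ht (by linarith)
      rw [add_sub_cancel_left] at h2
      have h3 := mul_le_mul_of_nonneg_right (h2.trans hah) (stateNorm_nonneg (center (x t)))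
      linarith [hcle t (t + h) ht (by linarith)]) ht
  refine key.trans ?_
  have := stateNorm_center_le (x 0)
  gcongr

/-- The averaging dynamics is a flow tracker. -/
theorem averagingDynamics_isFlowTracker (hL : ∀ τ, 0 ≤ τ → IsWeightBalanced (L τ))
    {Φ : ℝ → ℝ → Matrix (Fin n) (Fin n) ℝ} (hΦ : IsTransitionFlow L Φ)
    (hΦe : IsWeaklyExponentiallyErgodic Φ) :
    (averagingDynamics d L).IsFlowTracker Set.univ := by
  have hfst : ∀ (u x : ℝ → State n d) (w : ℝ → Fin 0 → ℝ),
      (averagingDynamics d L).IsTrajectory u x w →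
      IsPrimitiveFrom (fun τ => -act (L τ) (x τ) + u τ) 0 x := fun u x w h =>
    (isCaratheodorySolution_iff.1 h).map (ContinuousLinearMap.fst ℝ (State n d) (Fin 0 → ℝ))
  rcases Nat.eq_zero_or_pos n with rfl | hn
  · exact ⟨1, one_pos, 1 / 2, by norm_num, by norm_num, fun u x w _ h _ =>
      ⟨isPrimitiveFrom_average hL (hfst u x w h), fun _ _ i => i.elim0⟩⟩
  obtain ⟨lam, h0, h1, H⟩ := exists_stateNorm_center_le (d := d) hn hL hΦ hΦe
  exact ⟨4, by norm_num, lam, h0, h1, fun u x w hu h _ =>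
    ⟨isPrimitiveFrom_average hL (hfst u x w h), fun t ht i =>
      (norm_apply_le_stateNorm (center (x t)) i).trans (H u x hu (hfst u x w h) t ht)⟩⟩

end Tracking

/-! ### Scalar integral inequalities -/

section Scalar

/-- Tails of convergent integrals of nonnegative functions are small. -/
lemma exists_tail_integral_le {g : ℝ → ℝ} {B : ℝ}
    (hg : ∀ t, 0 ≤ t → IntervalIntegrable g volume 0 t)
    (hB : ∀ t, 0 ≤ t → ∫ τ in (0 : ℝ)..t, g τ ≤ B) (hg0 : ∀ t, 0 ≤ t → 0 ≤ g t)
    {ε : ℝ} (hε : 0 < ε) :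
    ∃ T, 0 ≤ T ∧ ∀ s t, T ≤ s → s ≤ t → ∫ τ in s..t, g τ ≤ ε := by
  set S : Set ℝ := (fun t => ∫ τ in (0 : ℝ)..t, g τ) '' Set.Ici 0
  have hne : S.Nonempty := ⟨_, 0, Set.self_mem_Ici, rfl⟩
  have hbdd : BddAbove S := ⟨B, by rintro _ ⟨t, ht, rfl⟩; exact hB t ht⟩
  -- From `T` on, the partial integrals are within `ε` of their supremum.
  obtain ⟨_, ⟨T, hT, rfl⟩, hlt⟩ := exists_lt_of_lt_csSup hne (sub_lt_self (sSup S) hε)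
  have hT : 0 ≤ T := hT
  refine ⟨T, hT, fun s t hTs hst => ?_⟩
  have hs : 0 ≤ s := hT.trans hTs
  have h1 := le_csSup hbdd ⟨t, hs.trans hst, rfl⟩
  have h2 := intervalIntegral.integral_add_adjacent_intervals (hg T hT)
    ((hg T hT).symm.trans (hg s hs))
  have h3 := intervalIntegral.integral_add_adjacent_intervals (hg s hs)
    ((hg s hs).symm.trans (hg t (hs.trans hst)))
  have h4 : 0 ≤ ∫ τ in T..s, g τ :=
    intervalIntegral.integral_nonneg hTs fun τ hτ => hg0 τ (hT.trans hτ.1)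
  beta_reduce at h1 hlt
  linarith

/-- A Grönwall inequality with integrable kernel. -/
lemma exists_bound_of_le_integral {a V : ℝ → ℝ} {D K S : ℝ} (hK : 0 ≤ K)
    (ha : ∀ t, 0 ≤ t → IntervalIntegrable a volume 0 t) (ha0 : ∀ t, 0 ≤ t → 0 ≤ a t)
    (haS : ∀ t, 0 ≤ t → ∫ τ in (0 : ℝ)..t, a τ ≤ S)
    (hV : ContinuousOn V (Set.Ici 0)) (hV0 : ∀ t, 0 ≤ t → 0 ≤ V t)
    (h : ∀ t, 0 ≤ t → V t ≤ D + K * ∫ τ in (0 : ℝ)..t, a τ * V τ) :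
    ∃ B, ∀ t, 0 ≤ t → V t ≤ B := by
  -- With this tail, `K` times the integral of `a` beyond `T` is at most `1 / 2`, so the maximum of
  -- `V` over `[T, t]` is absorbed into the left-hand side.
  obtain ⟨T, hT, htail⟩ := exists_tail_integral_le ha haS ha0
    (show 0 < 1 / (2 * (K + 1)) by positivity)
  have haII : ∀ s t, 0 ≤ s → 0 ≤ t → IntervalIntegrable a volume s t := fun s t hs ht =>
    (ha s hs).symm.trans (ha t ht)
  have haV : ∀ s t, 0 ≤ s → 0 ≤ t → IntervalIntegrable (fun τ => a τ * V τ) volume s t :=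
    fun s t hs ht => (haII s t hs ht).mul_continuousOn (continuousOn_uIcc_of_Ici hV hs ht)
  obtain ⟨p, -, hp⟩ := (isCompact_Icc (a := (0 : ℝ)) (b := T)).exists_isMaxOn ⟨T, hT, le_rfl⟩
    (hV.mono Set.Icc_subset_Ici_self)
  have hp : ∀ τ ∈ Set.Icc 0 T, V τ ≤ V p := hp
  refine ⟨max (V p) (2 * (D + K * ∫ τ in (0 : ℝ)..T, a τ * V τ)), fun t ht => ?_⟩
  rcases le_total t T with htT | hTt
  · exact le_max_of_le_left (hp t ⟨ht, htT⟩)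
  refine le_max_of_le_right ?_
  obtain ⟨r, ⟨hTr, hrt⟩, hr⟩ := (isCompact_Icc (a := T) (b := t)).exists_isMaxOn
    ⟨t, hTt, le_rfl⟩ (hV.mono fun τ hτ => hT.trans hτ.1)
  have hr : ∀ τ ∈ Set.Icc T t, V τ ≤ V r := hr
  have hr0 : 0 ≤ r := hT.trans hTr
  have h1 := h r hr0
  rw [← intervalIntegral.integral_add_adjacent_intervals (haV 0 T le_rfl hT)
    (haV T r hT hr0)] at h1
  have h2 : ∫ τ in T..r, a τ * V τ ≤ ∫ τ in T..r, a τ * V r :=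
    intervalIntegral.integral_mono_on hTr (haV T r hT hr0)
      ((haII T r hT hr0).mul_const _) fun τ hτ =>
        mul_le_mul_of_nonneg_left (hr τ ⟨hτ.1, hτ.2.trans hrt⟩) (ha0 τ (hT.trans hτ.1))
  rw [intervalIntegral.integral_mul_const] at h2
  have h3 := mul_le_mul_of_nonneg_right (htail T r le_rfl hTr) (hV0 r hr0)
  have h4 : K * (1 / (2 * (K + 1)) * V r) ≤ 1 / 2 * V r := by
    rw [← mul_assoc]
    refine mul_le_mul_of_nonneg_right ?_ (hV0 r hr0)
    rw [mul_one_div, div_le_div_iff₀ (by positivity) (by norm_num)]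
    linarith
  have h5 := mul_le_mul_of_nonneg_left (h2.trans h3) hK
  linarith [hr t ⟨hTt, le_rfl⟩]

/-- If `∫ α = ∞` and `∫ α G < ∞`, then `G` takes arbitrarily small values at large times. -/
lemma exists_lt_of_integral_mul_le {α G : ℝ → ℝ} {B : ℝ}
    (hα : ∀ t, 0 ≤ t → IntervalIntegrable α volume 0 t) (hα0 : ∀ t, 0 ≤ t → 0 ≤ α t)
    (hdiv : ∀ C, ∃ t, 0 ≤ t ∧ C < ∫ τ in (0 : ℝ)..t, α τ)
    (hG : ∀ t, 0 ≤ t → IntervalIntegrable (fun τ => α τ * G τ) volume 0 t)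
    (hG0 : ∀ t, 0 ≤ t → 0 ≤ G t)
    (hB : ∀ t, 0 ≤ t → ∫ τ in (0 : ℝ)..t, α τ * G τ ≤ B) {ε : ℝ} (hε : 0 < ε)
    {T : ℝ} (hT : 0 ≤ T) : ∃ t, T ≤ t ∧ G t < ε := by
  by_contra! hcon
  have hmono : ∀ s t, 0 ≤ s → s ≤ t → ∫ τ in (0 : ℝ)..s, α τ ≤ ∫ τ in (0 : ℝ)..t, α τ := by
    intro s t hs hst
    rw [← intervalIntegral.integral_add_adjacent_intervals (hα s hs)
      ((hα s hs).symm.trans (hα t (hs.trans hst)))]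
    have : 0 ≤ ∫ τ in s..t, α τ :=
      intervalIntegral.integral_nonneg hst fun τ hτ => hα0 τ (hs.trans hτ.1)
    linarith
  -- If `G ≥ ε` from `T` on, the integral of `α` beyond `T` is at most `B / ε`; the threshold is
  -- chosen to violate this.
  obtain ⟨t, ht, hlt⟩ := hdiv ((∫ τ in (0 : ℝ)..T, α τ) + B / ε)
  have hTr : T ≤ max t T := le_max_right _ _
  have hr : 0 ≤ max t T := hT.trans hTr
  have h1 := hmono t (max t T) ht (le_max_left _ _)
  have h2 := intervalIntegral.integral_add_adjacent_intervals (hα T hT)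
    ((hα T hT).symm.trans (hα _ hr))
  have h3 := intervalIntegral.integral_add_adjacent_intervals (hG T hT)
    ((hG T hT).symm.trans (hG _ hr))
  have h4 : ∫ τ in T..(max t T), α τ * ε ≤ ∫ τ in T..(max t T), α τ * G τ :=
    intervalIntegral.integral_mono_on hTr (((hα T hT).symm.trans (hα _ hr)).mul_const _)
      ((hG T hT).symm.trans (hG _ hr)) fun τ hτ =>
        mul_le_mul_of_nonneg_left (hcon τ hτ.1) (hα0 τ (hT.trans hτ.1))
  have h5 : 0 ≤ ∫ τ in (0 : ℝ)..T, α τ * G τ :=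
    intervalIntegral.integral_nonneg hT fun τ hτ => mul_nonneg (hα0 τ hτ.1) (hG0 τ hτ.1)
  rw [intervalIntegral.integral_mul_const] at h4
  have h6 : B / ε < ∫ τ in T..(max t T), α τ := by linarith
  rw [div_lt_iff₀ hε] at h6
  linarith [hB _ hr]

/-- The exponentially weighted integral of `β` solves `ġ = β + log lam * g`. -/
lemma isPrimitiveFrom_exp_weighted {lam A : ℝ} (hl : 0 < lam) {β : ℝ → ℝ}
    (hβ : ∀ t, 0 ≤ t → IntervalIntegrable β volume 0 t) :
    IsPrimitiveFrom
      (fun t => β t + Real.log lam *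
        (lam ^ t * A + ∫ τ in (0 : ℝ)..t, lam ^ (t - τ) * β τ)) 0
      (fun t => lam ^ t * A + ∫ τ in (0 : ℝ)..t, lam ^ (t - τ) * β τ) := by
  have hpow : IsPrimitiveFrom (fun t => Real.log lam * lam ^ t) 0 (fun t : ℝ => lam ^ t) :=
    isPrimitiveFrom_of_hasDerivAt
      (fun t => by simpa [mul_comm] using (hasDerivAt_id t).const_rpow hl)
      (continuous_const.mul (Real.continuous_const_rpow hl.ne'))
  have hcont : Continuous fun τ : ℝ => lam ^ (-τ) :=
    (Real.continuous_const_rpow hl.ne').comp continuous_neg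
  have hint : IsPrimitiveFrom (fun τ => 0 + lam ^ (-τ) * β τ) 0
      (fun t => A + ∫ τ in (0 : ℝ)..t, lam ^ (-τ) * β τ) :=
    (isPrimitiveFrom_const A).add (isPrimitiveFrom_integral fun t ht =>
      (hβ t ht).continuousOn_mul hcont.continuousOn)
  -- Factoring the kernel exhibits the convolution as a product of two primitives.
  have hsplit : ∀ t τ : ℝ, lam ^ (t - τ) = lam ^ t * lam ^ (-τ) := fun t τ => by
    rw [sub_eq_add_neg, Real.rpow_add hl]
  have heq : ∀ t : ℝ, lam ^ t * (A + ∫ τ in (0 : ℝ)..t, lam ^ (-τ) * β τ)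
      = lam ^ t * A + ∫ τ in (0 : ℝ)..t, lam ^ (t - τ) * β τ := fun t => by
    rw [mul_add, ← intervalIntegral.integral_const_mul]
    simp only [hsplit, mul_assoc]
  refine (hpow.mul hint).congr (fun t _ => ?_) (fun t _ => heq t)
  rw [← heq, zero_add, ← mul_assoc (lam ^ t) (lam ^ (-t)), ← Real.rpow_add hl, add_neg_cancel,
    Real.rpow_zero]
  ring

/-- Stable first-order filters map `L²` to `L²`. -/
lemma integral_sq_le_of_isPrimitiveFrom {κ : ℝ} (hκ : 0 < κ) {β g : ℝ → ℝ}
    (hg : IsPrimitiveFrom (fun t => β t - κ * g t) 0 g)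
    (hβ2 : ∀ t, 0 ≤ t → IntervalIntegrable (fun τ => β τ ^ 2) volume 0 t)
    {t : ℝ} (ht : 0 ≤ t) :
    κ * ∫ τ in (0 : ℝ)..t, g τ ^ 2 ≤ g 0 ^ 2 + κ⁻¹ * ∫ τ in (0 : ℝ)..t, β τ ^ 2 := by
  have hsq := hg.mul hg
  have hgII : IntervalIntegrable (fun τ => g τ ^ 2) volume 0 t :=
    ((hg.continuousOn_uIcc le_rfl ht).pow 2).intervalIntegrable
  have h1 := (hsq t ht).2
  have h2 : ∫ τ in (0 : ℝ)..t, ((β τ - κ * g τ) * g τ + g τ * (β τ - κ * g τ))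
      ≤ ∫ τ in (0 : ℝ)..t, (κ⁻¹ * β τ ^ 2 - κ * g τ ^ 2) := by
    refine intervalIntegral.integral_mono_on ht (hsq t ht).1
      (((hβ2 t ht).const_mul _).sub (hgII.const_mul _)) fun τ _ => ?_
    -- This square is exactly the slack in `2 (β - κ g) g ≤ κ⁻¹ β² - κ g²`.
    have h3 : 0 ≤ κ⁻¹ * (β τ - κ * g τ) ^ 2 := by positivity
    have h4 : κ⁻¹ * (β τ - κ * g τ) ^ 2 = κ⁻¹ * β τ ^ 2 - 2 * (β τ * g τ) + κ * g τ ^ 2 := by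
      field_simp
      ring
    linarith
  rw [intervalIntegral.integral_sub ((hβ2 t ht).const_mul _) (hgII.const_mul _),
    intervalIntegral.integral_const_mul, intervalIntegral.integral_const_mul] at h2
  nlinarith [mul_self_nonneg (g t)]

/-- The a priori estimate: if `R²` grows at most by `∫ α (1 + R) E`, where `E` is an
exponentially weighted integral of an input of size `α (1 + R)`, and `α` is square integrable,
then `∫ α (1 + R) E` converges. -/
lemma exists_integral_mul_le {α R β : ℝ → ℝ} {lam A c k M S : ℝ}
    (hl0 : 0 < lam) (hl1 : lam < 1) (hM : 0 ≤ M)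
    (hα : ∀ t, 0 ≤ t → IntervalIntegrable α volume 0 t)
    (hα2 : ∀ t, 0 ≤ t → IntervalIntegrable (fun τ => α τ ^ 2) volume 0 t)
    (hS : ∀ t, 0 ≤ t → ∫ τ in (0 : ℝ)..t, α τ ^ 2 ≤ S)
    (hR : ContinuousOn R (Set.Ici 0))
    (hβ : ∀ t, 0 ≤ t → IntervalIntegrable β volume 0 t) (hβ0 : ∀ t, 0 ≤ t → 0 ≤ β t)
    (hβle : ∀ t, 0 ≤ t → β t ≤ k * (α t * (1 + R t)))
    (h : ∀ t, 0 ≤ t → R t ^ 2 ≤ R 0 ^ 2 + M * ∫ τ in (0 : ℝ)..t, α τ * (1 + R τ) *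
      (c * (lam ^ τ * A + ∫ r in (0 : ℝ)..τ, lam ^ (τ - r) * β r))) :
    ∃ B, ∀ t, 0 ≤ t → ∫ τ in (0 : ℝ)..t, α τ * (1 + R τ) *
      (c * (lam ^ τ * A + ∫ r in (0 : ℝ)..τ, lam ^ (τ - r) * β r)) ≤ B := by
  have hg := isPrimitiveFrom_exp_weighted (A := A) hl0 hβ
  set g : ℝ → ℝ := fun t => lam ^ t * A + ∫ τ in (0 : ℝ)..t, lam ^ (t - τ) * β τ with hgdef
  have hκ : 0 < -Real.log lam := neg_pos.2 (Real.log_neg hl0 hl1)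
  set κ := -Real.log lam with hκdef
  have hg' : IsPrimitiveFrom (fun t => β t - κ * g t) 0 g :=
    hg.congr (fun t _ => by rw [hκdef]; ring) fun _ _ => rfl
  have hP2 : ∀ t, 0 ≤ t → IntervalIntegrable (fun τ => (α τ * (1 + R τ)) ^ 2) volume 0 t := by
    intro t ht
    simp only [mul_pow]
    exact (hα2 t ht).mul_continuousOn
      ((continuousOn_const.add (continuousOn_uIcc_of_Ici hR le_rfl ht)).pow 2)
  have hsqle : ∀ t, 0 ≤ t → β t ^ 2 ≤ k ^ 2 * (α t * (1 + R t)) ^ 2 := fun t ht => by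
    rw [← mul_pow]
    exact pow_le_pow_left₀ (hβ0 t ht) (hβle t ht) 2
  have hβ2 : ∀ t, 0 ≤ t → IntervalIntegrable (fun τ => β τ ^ 2) volume 0 t := by
    intro t ht
    refine ((hP2 t ht).const_mul (k ^ 2)).mono_fun' ?_ ?_
    · exact (hβ t ht).def'.aestronglyMeasurable.pow 2
    · refine (ae_restrict_iff' measurableSet_uIoc).2 (Eventually.of_forall fun τ hτ => ?_)
      rw [Set.uIoc_of_le ht] at hτ
      beta_reduce
      rw [Real.norm_of_nonneg (by positivity)]
      exact hsqle τ hτ.1.le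
  have hgII : ∀ t, 0 ≤ t → IntervalIntegrable (fun τ => g τ ^ 2) volume 0 t := fun t ht =>
    ((hg'.continuousOn_uIcc le_rfl ht).pow 2).intervalIntegrable
  have hPE : ∀ t, 0 ≤ t → IntervalIntegrable
      (fun τ => α τ * (1 + R τ) * (c * g τ)) volume 0 t := fun t ht =>
    ((hα t ht).mul_continuousOn
      (continuousOn_const.add (continuousOn_uIcc_of_Ici hR le_rfl ht))).mul_continuousOn
      (continuousOn_const.mul (hg'.continuousOn_uIcc le_rfl ht))
  -- Young's inequality separates the two factors, and the filter estimate bounds `∫ g²` by the `L²`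
  -- norm of `α (1 + R)` and the initial value.
  have hI : ∀ t, 0 ≤ t → ∫ τ in (0 : ℝ)..t, α τ * (1 + R τ) * (c * g τ)
      ≤ c ^ 2 / 2 * (κ⁻¹ * g 0 ^ 2) +
        (1 / 2 + c ^ 2 / 2 * (κ⁻¹ * κ⁻¹ * k ^ 2)) *
          ∫ τ in (0 : ℝ)..t, (α τ * (1 + R τ)) ^ 2 := by
    intro t ht
    have h1 : ∫ τ in (0 : ℝ)..t, α τ * (1 + R τ) * (c * g τ) ≤
        ∫ τ in (0 : ℝ)..t, (1 / 2 * (α τ * (1 + R τ)) ^ 2 + c ^ 2 / 2 * g τ ^ 2) :=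
      intervalIntegral.integral_mono_on ht (hPE t ht)
        (((hP2 t ht).const_mul _).add ((hgII t ht).const_mul _)) fun τ _ => by
          nlinarith [sq_nonneg (α τ * (1 + R τ) - c * g τ)]
    rw [intervalIntegral.integral_add ((hP2 t ht).const_mul _) ((hgII t ht).const_mul _),
      intervalIntegral.integral_const_mul, intervalIntegral.integral_const_mul] at h1
    have h2 := integral_sq_le_of_isPrimitiveFrom hκ hg' hβ2 ht
    have h3 : ∫ τ in (0 : ℝ)..t, β τ ^ 2 ≤ k ^ 2 * ∫ τ in (0 : ℝ)..t, (α τ * (1 + R τ)) ^ 2 := by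
      rw [← intervalIntegral.integral_const_mul]
      exact intervalIntegral.integral_mono_on ht (hβ2 t ht) ((hP2 t ht).const_mul _)
        fun τ hτ => hsqle τ hτ.1
    have h4 : ∫ τ in (0 : ℝ)..t, g τ ^ 2 ≤ κ⁻¹ * (g 0 ^ 2 + κ⁻¹ *
        (k ^ 2 * ∫ τ in (0 : ℝ)..t, (α τ * (1 + R τ)) ^ 2)) := by
      rw [← div_eq_inv_mul, le_div_iff₀ hκ, mul_comm]
      refine h2.trans ?_
      gcongr
    have h5 := mul_le_mul_of_nonneg_left h4 (show 0 ≤ c ^ 2 / 2 by positivity)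
    linarith
  have hPle : ∀ t, 0 ≤ t → ∫ τ in (0 : ℝ)..t, (α τ * (1 + R τ)) ^ 2 ≤
      2 * ∫ τ in (0 : ℝ)..t, α τ ^ 2 * (1 + R τ ^ 2) := by
    intro t ht
    rw [← intervalIntegral.integral_const_mul]
    refine intervalIntegral.integral_mono_on ht (hP2 t ht) (((hα2 t ht).mul_continuousOn
      (continuousOn_const.add ((continuousOn_uIcc_of_Ici hR le_rfl ht).pow 2))).const_mul _)
      fun τ _ => ?_
    nlinarith [sq_nonneg (α τ), mul_nonneg (sq_nonneg (α τ)) (sq_nonneg (1 - R τ))]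
  set C1 : ℝ := c ^ 2 / 2 * (κ⁻¹ * g 0 ^ 2)
  set C2 : ℝ := 1 / 2 + c ^ 2 / 2 * (κ⁻¹ * κ⁻¹ * k ^ 2)
  have hC2 : 0 ≤ C2 := by positivity
  have hI' : ∀ t, 0 ≤ t → ∫ τ in (0 : ℝ)..t, α τ * (1 + R τ) * (c * g τ)
      ≤ C1 + 2 * C2 * ∫ τ in (0 : ℝ)..t, α τ ^ 2 * (1 + R τ ^ 2) := fun t ht => by
    have := mul_le_mul_of_nonneg_left (hPle t ht) hC2
    linarith [hI t ht]
  -- The error is now linear in `∫ α² (1 + R²)`, so Grönwall applies to `1 + R²` with the integrable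
  -- kernel `α²`.
  obtain ⟨V, hV⟩ := exists_bound_of_le_integral (a := fun τ => α τ ^ 2)
    (V := fun τ => 1 + R τ ^ 2) (D := 1 + R 0 ^ 2 + M * C1) (K := M * (2 * C2))
    (by positivity) hα2 (fun t _ => sq_nonneg _) hS (continuousOn_const.add (hR.pow 2))
    (fun t _ => by positivity) (fun t ht => by
      have := mul_le_mul_of_nonneg_left (hI' t ht) hM
      linarith [h t ht])
  have hV0 : 0 ≤ V := le_trans (by positivity) (hV 0 le_rfl)
  refine ⟨C1 + 2 * C2 * (S * V), fun t ht => (hI' t ht).trans ?_⟩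
  have h1 : ∫ τ in (0 : ℝ)..t, α τ ^ 2 * (1 + R τ ^ 2) ≤ ∫ τ in (0 : ℝ)..t, α τ ^ 2 * V :=
    intervalIntegral.integral_mono_on ht ((hα2 t ht).mul_continuousOn
      (continuousOn_const.add ((continuousOn_uIcc_of_Ici hR le_rfl ht).pow 2)))
      ((hα2 t ht).mul_const _) fun τ hτ =>
        mul_le_mul_of_nonneg_left (hV τ hτ.1) (sq_nonneg _)
  rw [intervalIntegral.integral_mul_const] at h1
  have h2 := mul_le_mul_of_nonneg_right (hS t ht) hV0
  gcongr
  exact h1.trans h2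

end Scalar

/-! ### Step sizes -/

section StepSize

variable {α : ℝ → ℝ}

lemma IsStepSize.integrableOn_sq (h : IsStepSize α) :
    IntegrableOn (fun t => α t ^ 2) (Set.Ici 0) := by
  refine ⟨(h.measurable.pow_const 2).aestronglyMeasurable, ?_⟩
  rw [hasFiniteIntegral_iff_ofReal (Eventually.of_forall fun t => sq_nonneg _)]
  exact h.sq_integral_lt_top

lemma IsStepSize.intervalIntegrable_sq (h : IsStepSize α) {t : ℝ} (ht : 0 ≤ t) :
    IntervalIntegrable (fun τ => α τ ^ 2) volume 0 t :=
  (intervalIntegrable_iff_integrableOn_Icc_of_le ht).2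
    (h.integrableOn_sq.mono_set Set.Icc_subset_Ici_self)

lemma IsStepSize.integral_sq_le (h : IsStepSize α) {t : ℝ} (ht : 0 ≤ t) :
    ∫ τ in (0 : ℝ)..t, α τ ^ 2 ≤ ∫ τ in Set.Ici (0 : ℝ), α τ ^ 2 := by
  rw [intervalIntegral.integral_of_le ht]
  exact setIntegral_mono_set h.integrableOn_sq (Eventually.of_forall fun _ => sq_nonneg _)
    (Set.Ioc_subset_Icc_self.trans Set.Icc_subset_Ici_self).eventuallyLE

/-- Local integrability follows from `|α| ≤ 1 + α²`. -/
lemma IsStepSize.intervalIntegrable (h : IsStepSize α) {t : ℝ} (ht : 0 ≤ t) :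
    IntervalIntegrable α volume 0 t := by
  refine (intervalIntegrable_const (c := (1 : ℝ)).add (h.intervalIntegrable_sq ht)).mono_fun'
    ?_ (Eventually.of_forall fun τ => ?_)
  · refine (h.measurable.mono_measure (Measure.restrict_mono ?_ le_rfl)).aestronglyMeasurable
    rw [Set.uIoc_of_le ht]
    exact Set.Ioc_subset_Icc_self.trans Set.Icc_subset_Ici_self
  · beta_reduce
    rw [Real.norm_eq_abs]
    nlinarith [sq_abs (α τ), sq_nonneg (|α τ| - 1)]

/-- Bounded partial integrals of a nonnegative function would make it integrable on the half-line,
contradicting the infinite `lintegral`. -/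
lemma IsStepSize.exists_lt_integral (h : IsStepSize α) (C : ℝ) :
    ∃ t, 0 ≤ t ∧ C < ∫ τ in (0 : ℝ)..t, α τ := by
  by_contra! hcon
  have hint : IntegrableOn α (Set.Ioi 0) := by
    refine integrableOn_Ioi_of_intervalIntegral_norm_bounded (l := atTop) (b := id) C 0
      (fun t => ?_) tendsto_id ?_
    · rcases le_total 0 t with ht | ht
      · exact (intervalIntegrable_iff_integrableOn_Ioc_of_le ht).1 (h.intervalIntegrable ht)
      · simp [Set.Ioc_eq_empty_of_le ht]
    · filter_upwards [eventually_ge_atTop 0] with t ht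
      refine le_of_eq_of_le (intervalIntegral.integral_congr fun τ hτ => ?_) (hcon t ht)
      rw [id, Set.uIcc_of_le ht] at hτ
      exact Real.norm_of_nonneg (h.nonneg τ hτ.1)
  rw [← integrableOn_Ici_iff_integrableOn_Ioi] at hint
  have hfin := hint.hasFiniteIntegral
  rw [hasFiniteIntegral_iff_ofReal] at hfin
  · exact hfin.ne h.integral_eq_top
  · exact (ae_restrict_iff' measurableSet_Ici).2 (Eventually.of_forall h.nonneg)

end StepSize

/-! ### Convexity estimates -/

section Convexity

/-- On the segment from `y` to `z`, the derivative at `0` is at most the slope over `[0, 1]`. -/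
lemma add_inner_gradient_le_of_convexOn {H : Type*} [NormedAddCommGroup H] [InnerProductSpace ℝ H]
    [CompleteSpace H] {f : H → ℝ} (hf : ConvexOn ℝ Set.univ f) {y : H}
    (hd : DifferentiableAt ℝ f y) (z : H) : f y + inner ℝ (gradient f y) (z - y) ≤ f z := by
  have hline : ConvexOn ℝ Set.univ (f ∘ AffineMap.lineMap y z : ℝ → ℝ) := by
    simpa using hf.comp_affineMap (AffineMap.lineMap y z : ℝ →ᵃ[ℝ] H)
  have hder : HasDerivAt (f ∘ AffineMap.lineMap y z : ℝ → ℝ)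
      (inner ℝ (gradient f y) (z - y)) 0 := by
    have h1 : HasFDerivAt f (InnerProductSpace.toDual ℝ H (gradient f y))
        (AffineMap.lineMap y z (0 : ℝ)) := by
      rw [AffineMap.lineMap_apply_zero]
      exact hd.hasGradientAt.hasFDerivAt
    simpa using h1.comp_hasDerivAt (0 : ℝ) AffineMap.hasDerivAt_lineMap
  have h := hline.le_slope_of_hasDerivAt (Set.mem_univ 0) (Set.mem_univ 1) one_pos hder
  simp only [slope_def_field, Function.comp_apply, AffineMap.lineMap_apply_zero,
    AffineMap.lineMap_apply_one, sub_zero, div_one] at h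
  linarith

variable {n d : ℕ}

lemma norm_average_sub_le (hn : 0 < n) (x : State n d) (z : EuclideanSpace ℝ (Fin d)) :
    ‖average x - z‖ ≤ stateNorm (fun i => x i - z) := by
  have hn' : (n : ℝ) ≠ 0 := by positivity
  have h : average x - z = (n : ℝ)⁻¹ • ∑ i, (x i - z) := by
    rw [Finset.sum_sub_distrib, smul_sub, average, Finset.sum_const, Finset.card_univ,
      Fintype.card_fin, ← Nat.cast_smul_eq_nsmul ℝ, inv_smul_smul₀ hn']
  rw [h, norm_smul, norm_inv, Real.norm_natCast, inv_mul_le_iff₀ (by positivity)]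
  refine (norm_sum_le _ _).trans ?_
  refine (Finset.sum_le_card_nsmul _ _ _ fun i _ =>
    norm_apply_le_stateNorm (fun i => x i - z) i).trans ?_
  rw [Finset.card_univ, Fintype.card_fin, nsmul_eq_mul]

variable {f : Fin n → EuclideanSpace ℝ (Fin d) → ℝ} {K : ℝ}

/-- Recenters the linear growth at `z`, using `1 + ‖w‖ ≤ (1 + ‖z‖) (1 + r)`. -/
lemma norm_gradient_le (hK : 0 ≤ K) (hgrow : ∀ i w, ‖gradient (f i) w‖ ≤ K * (1 + ‖w‖))
    {r : ℝ} (i : Fin n) {w z : EuclideanSpace ℝ (Fin d)} (hw : ‖w - z‖ ≤ r) :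
    ‖gradient (f i) w‖ ≤ K * (1 + ‖z‖) * (1 + r) := by
  refine (hgrow i w).trans ?_
  rw [mul_assoc]
  refine mul_le_mul_of_nonneg_left ?_ hK
  have h1 := norm_le_norm_add_norm_sub' w z
  have h2 : 0 ≤ ‖z‖ * r := mul_nonneg (norm_nonneg _) ((norm_nonneg _).trans hw)
  linarith

lemma stateNorm_stackedGradient_le (hK : 0 ≤ K)
    (hgrow : ∀ i w, ‖gradient (f i) w‖ ≤ K * (1 + ‖w‖)) (x : State n d)
    (z : EuclideanSpace ℝ (Fin d)) :
    stateNorm (stackedGradient f x)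
      ≤ n * (K * (1 + ‖z‖)) * (1 + stateNorm (fun i => x i - z)) := by
  refine (stateNorm_le_sum _).trans ((Finset.sum_le_card_nsmul _ _ _ fun i _ =>
    norm_gradient_le hK hgrow i (norm_apply_le_stateNorm (fun i => x i - z) i)).trans ?_)
  rw [Finset.card_univ, Fintype.card_fin, nsmul_eq_mul, mul_assoc (n : ℝ)]

/-- Convexity is used at `x i` towards `z` and at the average towards `x i`, so that `f i (x i)`
cancels. What remains is the gradient at the average, bounded by linear growth, times the
disagreement. -/
lemma neg_sum_inner_stackedGradient_le (hn : 0 < n) (hconv : ∀ i, ConvexOn ℝ Set.univ (f i))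
    (hdiff : ∀ i, Differentiable ℝ (f i)) (hK : 0 ≤ K)
    (hgrow : ∀ i w, ‖gradient (f i) w‖ ≤ K * (1 + ‖w‖)) (x : State n d)
    (z : EuclideanSpace ℝ (Fin d)) {E : ℝ} (hE : stateNorm (center x) ≤ E) :
    -∑ i, inner ℝ (x i - z) (stackedGradient f x i) ≤
      -(∑ i, f i (average x) - ∑ i, f i z)
        + n * (K * (1 + ‖z‖)) * ((1 + stateNorm (fun i => x i - z)) * E) := by
  have hi : ∀ i, -inner ℝ (x i - z) (stackedGradient f x i) ≤
      -(f i (average x) - f i z)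
        + K * (1 + ‖z‖) * (1 + stateNorm (fun i => x i - z)) * E := fun i => by
    have h1 := add_inner_gradient_le_of_convexOn (hconv i) (hdiff i (x i)) z
    have h2 := add_inner_gradient_le_of_convexOn (hconv i) (hdiff i (average x)) (x i)
    have h3 := norm_gradient_le hK hgrow i (norm_average_sub_le hn x z)
    have h4 := (norm_apply_le_stateNorm (center x) i).trans hE
    have h5 := neg_le_of_abs_le (abs_real_inner_le_norm (gradient (f i) (average x))
      (x i - average x))
    have h6 : ‖gradient (f i) (average x)‖ * ‖x i - average x‖ ≤
        K * (1 + ‖z‖) * (1 + stateNorm (fun i => x i - z)) * E :=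
      mul_le_mul h3 h4 (norm_nonneg _) ((norm_nonneg _).trans h3)
    have h7 : inner ℝ (x i - z) (stackedGradient f x i)
        = -inner ℝ (gradient (f i) (x i)) (z - x i) := by
      rw [real_inner_comm, ← inner_neg_right, neg_sub]
      rfl
    linarith
  have h := Finset.sum_le_sum fun i (_ : i ∈ Finset.univ) => hi i
  rw [Finset.sum_neg_distrib, Finset.sum_add_distrib, Finset.sum_neg_distrib,
    Finset.sum_sub_distrib, Finset.sum_const, Finset.card_univ, Fintype.card_fin,
    nsmul_eq_mul] at h
  linarith

end Convexity

/-! ### Distributed gradient flow -/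

section GradientFlow

variable {n d : ℕ} {L : ℝ → Matrix (Fin n) (Fin n) ℝ} {α : ℝ → ℝ}
  {f : Fin n → EuclideanSpace ℝ (Fin d) → ℝ} {x : ℝ → State n d}

/-- A solution only provides integrability of the whole velocity; this isolates that of the gradient
input, which tracking requires. -/
lemma intervalIntegrable_act (hLm : IsMeasurableOnHalfLine L)
    (hLb : IsLocallyEssentiallyBounded L) (hx : ContinuousOn x (Set.Ici 0)) {t : ℝ}
    (ht : 0 ≤ t) : IntervalIntegrable (fun τ => act (L τ) (x τ)) volume 0 t := by
  have hLij : ∀ i j, IntervalIntegrable (fun τ => L τ i j) volume 0 t := fun i j => by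
    obtain ⟨M, hM⟩ := hLb t
    rw [intervalIntegrable_iff_integrableOn_Icc_of_le ht]
    exact Integrable.of_bound ((hLm i j).mono_measure
      (Measure.restrict_mono Set.Icc_subset_Ici_self le_rfl)).aestronglyMeasurable M
      (hM.mono fun τ hτ => hτ i j)
  have hij : ∀ i j, IntervalIntegrable (fun τ => L τ i j • x τ j) volume 0 t := fun i j =>
    (hLij i j).smul_continuousOn
      ((continuous_apply j).comp_continuousOn (continuousOn_uIcc_of_Ici hx le_rfl ht))
  have hi : ∀ i, IntervalIntegrable (fun τ => act (L τ) (x τ) i) volume 0 t := fun i => by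
    have h := IntervalIntegrable.sum Finset.univ fun j _ => hij i j
    have heq : (fun τ => act (L τ) (x τ) i) = ∑ j, fun τ => L τ i j • x τ j := by
      funext τ
      simp [act]
    rwa [heq]
  exact ⟨integrable_pi_iff.2 fun i => (hi i).1, integrable_pi_iff.2 fun i => (hi i).2⟩

lemma continuousOn_objective_average (hdiff : ∀ i, Differentiable ℝ (f i))
    (hx : ContinuousOn x (Set.Ici 0)) :
    ContinuousOn (fun τ => ∑ i, f i (average (x τ))) (Set.Ici 0) := by
  have h : ContinuousOn (fun τ => average (x τ)) (Set.Ici 0) := by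
    simp only [← averageCLM_apply]
    exact (averageCLM n d).continuous.comp_continuousOn hx
  exact continuousOn_finsetSum _ fun i _ => (hdiff i).continuous.comp_continuousOn h

lemma continuousOn_stateNorm_sub (hx : ContinuousOn x (Set.Ici 0))
    (z : EuclideanSpace ℝ (Fin d)) :
    ContinuousOn (fun τ => stateNorm (fun i => x τ i - z)) (Set.Ici 0) :=
  continuous_stateNorm.comp_continuousOn (hx.sub (continuousOn_const (c := fun _ => z)))

/-- Dissipation along the distributed gradient flow: the squared distance to consensus at `z`
decreases at the rate of the optimality gap, up to an error of the size of the disagreement. -/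
lemma stateNorm_sub_sq_le (hn : 0 < n) (hL : ∀ τ, 0 ≤ τ → IsWeightBalanced (L τ))
    (hα : IsStepSize α) (hconv : ∀ i, ConvexOn ℝ Set.univ (f i))
    (hdiff : ∀ i, Differentiable ℝ (f i)) {K : ℝ} (hK : 0 ≤ K)
    (hgrow : ∀ i w, ‖gradient (f i) w‖ ≤ K * (1 + ‖w‖))
    (hx : IsPrimitiveFrom
      (fun τ => -act (L τ) (x τ) + -(α τ • stackedGradient f (x τ))) 0 x)
    {E : ℝ → ℝ} (hEc : ContinuousOn E (Set.Ici 0))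
    (hE : ∀ t, 0 ≤ t → stateNorm (center (x t)) ≤ E t) (z : EuclideanSpace ℝ (Fin d))
    {s t : ℝ} (hs : 0 ≤ s) (hst : s ≤ t) :
    stateNorm (fun i => x t i - z) ^ 2 ≤ stateNorm (fun i => x s i - z) ^ 2
      - 2 * (∫ τ in s..t, α τ * (∑ i, f i (average (x τ)) - ∑ i, f i z))
      + 2 * (n * (K * (1 + ‖z‖))) *
        ∫ τ in s..t, α τ * (1 + stateNorm (fun i => x τ i - z)) * E τ := by
  have ht := hs.trans hst
  have hα' : IntervalIntegrable α volume s t :=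
    (hα.intervalIntegrable hs).symm.trans (hα.intervalIntegrable ht)
  have hsub : IsPrimitiveFrom
      (fun τ => -act (L τ) (x τ) + -(α τ • stackedGradient f (x τ))) s
      (fun τ i => x τ i - z) := by
    have h := (hx.restart hs).sub (isPrimitiveFrom_const (fun _ : Fin n => z))
    exact h.congr (fun τ _ => sub_zero _) fun _ _ => rfl
  have h1 : IntervalIntegrable
      (fun τ => α τ * (∑ i, f i (average (x τ)) - ∑ i, f i z)) volume s t :=
    hα'.mul_continuousOn ((continuousOn_uIcc_of_Ici
      (continuousOn_objective_average hdiff hx.continuousOn) hs ht).sub continuousOn_const)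
  have h2 : IntervalIntegrable
      (fun τ => α τ * (1 + stateNorm (fun i => x τ i - z)) * E τ) volume s t :=
    (hα'.mul_continuousOn (continuousOn_const.add (continuousOn_uIcc_of_Ici
      (continuousOn_stateNorm_sub hx.continuousOn z) hs ht))).mul_continuousOn
      (continuousOn_uIcc_of_Ici hEc hs ht)
  have hen := (hsub.stateNorm_sq t hst).2
  beta_reduce at hen
  rw [hen, sub_add, add_comm (stateNorm _ ^ 2), sub_eq_neg_add, add_le_add_iff_right,
    ← intervalIntegral.integral_const_mul, ← intervalIntegral.integral_const_mul,
    ← intervalIntegral.integral_sub (h1.const_mul _) (h2.const_mul _),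
    ← intervalIntegral.integral_neg]
  refine intervalIntegral.integral_mono_on hst (hsub.stateNorm_sq t hst).1
    ((h1.const_mul _).sub (h2.const_mul _)).neg fun τ hτ => ?_
  have hτ0 : 0 ≤ τ := hs.trans hτ.1
  have h3 := (hL τ hτ0).sum_inner_act_nonneg (fun i => x τ i - z)
  -- Shifting by consensus at `z` is invisible to `L`, so the averaging term is dissipative relative
  -- to any `z`.
  have h4 : act (L τ) (fun i => x τ i - z) = act (L τ) (x τ) := by
    have : (fun i => x τ i - z) = x τ - fun _ => z := rfl
    rw [this, act_sub, (hL τ hτ0).act_const, sub_zero]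
  rw [h4] at h3
  have h5 := mul_le_mul_of_nonneg_left
    (neg_sum_inner_stackedGradient_le hn hconv hdiff hK hgrow (x τ) z (hE τ hτ0))
    (hα.nonneg τ hτ0)
  simp only [Pi.add_apply, Pi.neg_apply, Pi.smul_apply, inner_add_right, inner_neg_right,
    real_inner_smul_right, Finset.sum_add_distrib, Finset.sum_neg_distrib, ← Finset.mul_sum]
  linarith

end GradientFlow

/-! ### Convergence to consensus at a minimizer -/

section Convergence

variable {n d : ℕ} {L : ℝ → Matrix (Fin n) (Fin n) ℝ} {α : ℝ → ℝ}
  {f : Fin n → EuclideanSpace ℝ (Fin d) → ℝ} {x : ℝ → State n d}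

lemma stateNorm_sub_le (x : State n d) (z : EuclideanSpace ℝ (Fin d)) {E : ℝ}
    (hE : stateNorm (center x) ≤ E) :
    stateNorm (fun i => x i - z) ≤ n * (E + ‖average x - z‖) := by
  refine (stateNorm_le_sum _).trans ((Finset.sum_le_card_nsmul _ _ (E + ‖average x - z‖)
    fun i _ => ?_).trans ?_)
  · rw [← sub_add_sub_cancel (x i) (average x) z]
    refine (norm_add_le _ _).trans ?_
    gcongr
    exact (norm_apply_le_stateNorm (center x) i).trans hE
  · rw [Finset.card_univ, Fintype.card_fin, nsmul_eq_mul]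

/-- Quasi-Fejér monotonicity: a nonnegative function which increases at most by the integral
of an integrable function, and which is arbitrarily small along a sequence of times, tends to
zero. -/
lemma tendsto_zero_of_quasiFejer {R g : ℝ → ℝ} {B : ℝ}
    (hg : ∀ t, 0 ≤ t → IntervalIntegrable g volume 0 t) (hg0 : ∀ t, 0 ≤ t → 0 ≤ g t)
    (hB : ∀ t, 0 ≤ t → ∫ τ in (0 : ℝ)..t, g τ ≤ B) (hR0 : ∀ t, 0 ≤ R t)
    (hR : ∀ s t, 0 ≤ s → s ≤ t → R t ^ 2 ≤ R s ^ 2 + ∫ τ in s..t, g τ)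
    {T : ℕ → ℝ} (hT : Tendsto T atTop atTop) (hRT : Tendsto (fun k => R (T k)) atTop (𝓝 0)) :
    Tendsto R atTop (𝓝 0) := by
  rw [Metric.tendsto_atTop]
  intro ε hε
  obtain ⟨T₀, hT₀, htail⟩ := exists_tail_integral_le hg hB hg0
    (show 0 < ε ^ 2 / 2 by positivity)
  have hsq : Tendsto (fun k => R (T k) ^ 2) atTop (𝓝 0) := by simpa using hRT.pow 2
  obtain ⟨k, hk1, hk2⟩ := ((hT.eventually_ge_atTop T₀).and
    (hsq.eventually (gt_mem_nhds (show 0 < ε ^ 2 / 2 by positivity)))).exists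
  refine ⟨T k, fun t ht => ?_⟩
  rw [Real.dist_eq, sub_zero, abs_of_nonneg (hR0 t)]
  refine lt_of_pow_lt_pow_left₀ 2 hε.le ?_
  linarith [hR (T k) t (hT₀.trans hk1) ht, htail (T k) t hk1 ht]

/-- Trajectories of the distributed gradient flow converge to consensus at a minimizer. -/
theorem exists_tendsto_minimizer (hn : 0 < n) (hLm : IsMeasurableOnHalfLine L)
    (hLb : IsLocallyEssentiallyBounded L) (hL : ∀ τ, 0 ≤ τ → IsWeightBalanced (L τ))
    {Φ : ℝ → ℝ → Matrix (Fin n) (Fin n) ℝ} (hΦ : IsTransitionFlow L Φ)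
    (hΦe : IsWeaklyExponentiallyErgodic Φ) (hα : IsStepSize α) (hf : IsAdmissibleProblem f)
    (hx : IsPrimitiveFrom
      (fun τ => -act (L τ) (x τ) + -(α τ • stackedGradient f (x τ))) 0 x) :
    ∃ xstar ∈ minimizers f, ∀ i, Tendsto (fun t => x t i) atTop (𝓝 xstar) := by
  obtain ⟨lam, hl0, hl1, htrack⟩ := exists_stateNorm_center_le (d := d) hn hL hΦ hΦe
  obtain ⟨K, hK, hgrow⟩ : ∃ K, 0 ≤ K ∧ ∀ i w, ‖gradient (f i) w‖ ≤ K * (1 + ‖w‖) := by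
    obtain ⟨K, hK⟩ := hf.gradient_growth
    exact ⟨|K|, abs_nonneg K, fun i w => (hK i w).trans
      (mul_le_mul_of_nonneg_right (le_abs_self K) (by positivity))⟩
  have hu : ∀ t, 0 ≤ t →
      IntervalIntegrable (fun τ => -(α τ • stackedGradient f (x τ))) volume 0 t := by
    intro t ht
    have h := (hx t ht).1.add (intervalIntegrable_act hLm hLb hx.continuousOn ht)
    have heq : (fun τ => -(α τ • stackedGradient f (x τ))) = fun τ =>
        -act (L τ) (x τ) + -(α τ • stackedGradient f (x τ)) + act (L τ) (x τ) := by
      funext τ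
      abel
    rwa [heq]
  set β : ℝ → ℝ := fun τ => stateNorm (-(α τ • stackedGradient f (x τ))) with hβdef
  have hβ : ∀ t, 0 ≤ t → IntervalIntegrable β volume 0 t := fun t ht =>
    intervalIntegrable_stateNorm (hu t ht)
  have hβ0 : ∀ t, 0 ≤ β t := fun t => stateNorm_nonneg _
  -- This majorant replaces the disagreement because it comes from a linear scalar equation, which
  -- makes its `L²` norm accessible.
  set E : ℝ → ℝ := fun t =>
    4 * (lam ^ t * stateNorm (x 0) + ∫ τ in (0 : ℝ)..t, lam ^ (t - τ) * β τ) with hEdef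
  have hE : ∀ t, 0 ≤ t → stateNorm (center (x t)) ≤ E t := fun t ht => htrack _ x hu hx t ht
  have hEc : ContinuousOn E (Set.Ici 0) :=
    continuousOn_const.mul (isPrimitiveFrom_exp_weighted hl0 hβ).continuousOn
  have hE0 : ∀ t, 0 ≤ t → 0 ≤ E t := fun t ht => (stateNorm_nonneg _).trans (hE t ht)
  set R : EuclideanSpace ℝ (Fin d) → ℝ → ℝ := fun z t => stateNorm (fun i => x t i - z)
    with hRdef
  have hR0 : ∀ z t, 0 ≤ R z t := fun z t => stateNorm_nonneg _
  have hRc : ∀ z, ContinuousOn (R z) (Set.Ici 0) := fun z =>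
    continuousOn_stateNorm_sub hx.continuousOn z
  have hαE : ∀ t, 0 ≤ t → IntervalIntegrable (fun τ => α τ * E τ) volume 0 t := fun t ht =>
    (hα.intervalIntegrable ht).mul_continuousOn (continuousOn_uIcc_of_Ici hEc le_rfl ht)
  have hg : ∀ z t, 0 ≤ t → IntervalIntegrable (fun τ => α τ * (1 + R z τ) * E τ) volume 0 t :=
    fun z t ht => ((hα.intervalIntegrable ht).mul_continuousOn (continuousOn_const.add
      (continuousOn_uIcc_of_Ici (hRc z) le_rfl ht))).mul_continuousOn
      (continuousOn_uIcc_of_Ici hEc le_rfl ht)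
  have hg0 : ∀ z t, 0 ≤ t → 0 ≤ α t * (1 + R z t) * E t := fun z t ht =>
    mul_nonneg (mul_nonneg (hα.nonneg t ht) (by linarith [hR0 z t])) (hE0 t ht)
  have hF : ∀ z t, 0 ≤ t → IntervalIntegrable
      (fun τ => α τ * (∑ i, f i (average (x τ)) - ∑ i, f i z)) volume 0 t := fun z t ht =>
    (hα.intervalIntegrable ht).mul_continuousOn ((continuousOn_uIcc_of_Ici
      (continuousOn_objective_average hf.differentiable hx.continuousOn) le_rfl ht).sub
      continuousOn_const)
  set M : EuclideanSpace ℝ (Fin d) → ℝ := fun z => 2 * (n * (K * (1 + ‖z‖))) with hMdef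
  have hM0 : ∀ z, 0 ≤ M z := fun z => by positivity
  have hdiss : ∀ z s t, 0 ≤ s → s ≤ t → R z t ^ 2 ≤ R z s ^ 2
      - 2 * (∫ τ in s..t, α τ * (∑ i, f i (average (x τ)) - ∑ i, f i z))
      + M z * ∫ τ in s..t, α τ * (1 + R z τ) * E τ := fun z s t hs hst =>
    stateNorm_sub_sq_le hn hL hα hf.convex hf.differentiable hK hgrow hx hEc hE z hs hst
  have hfejer : ∀ z ∈ minimizers f, ∀ s t, 0 ≤ s → s ≤ t →
      R z t ^ 2 ≤ R z s ^ 2 + M z * ∫ τ in s..t, α τ * (1 + R z τ) * E τ := by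
    intro z hz s t hs hst
    have h0 : 0 ≤ ∫ τ in s..t, α τ * (∑ i, f i (average (x τ)) - ∑ i, f i z) :=
      intervalIntegral.integral_nonneg hst fun τ hτ =>
        mul_nonneg (hα.nonneg τ (hs.trans hτ.1)) (sub_nonneg.2 (hz _))
    linarith [hdiss z s t hs hst]
  -- Stated for every minimizer: it serves first for an arbitrary one, then for the limit point
  -- found by compactness.
  have hbound : ∀ z ∈ minimizers f, ∃ B, ∀ t, 0 ≤ t →
      ∫ τ in (0 : ℝ)..t, α τ * (1 + R z τ) * E τ ≤ B := fun z hz =>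
    exists_integral_mul_le (k := n * (K * (1 + ‖z‖))) hl0 hl1 (hM0 z)
      (fun t ht => hα.intervalIntegrable ht) (fun t ht => hα.intervalIntegrable_sq ht)
      (fun t ht => hα.integral_sq_le ht) (hRc z) hβ (fun t _ => hβ0 t)
      (fun t ht => by
        have h1 := mul_le_mul_of_nonneg_left (stateNorm_stackedGradient_le hK hgrow (x t) z)
          (hα.nonneg t ht)
        have h2 : β t = α t * stateNorm (stackedGradient f (x t)) := by
          simp only [hβdef, stateNorm_eq_norm_toLp, WithLp.toLp_neg, WithLp.toLp_smul, norm_neg,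
            norm_smul, Real.norm_of_nonneg (hα.nonneg t ht)]
        rw [h2]
        refine h1.trans (le_of_eq ?_)
        simp only [hRdef]
        ring)
      (fun t ht => hfejer z hz 0 t le_rfl ht)
  obtain ⟨z, hz⟩ := hf.nonempty
  obtain ⟨B, hB⟩ := hbound z hz
  set gap : ℝ → ℝ := fun t => ∑ i, f i (average (x t)) - ∑ i, f i z with hgap
  have hgap0 : ∀ t, 0 ≤ gap t := fun t => sub_nonneg.2 (hz _)
  -- The gap and `E` are summed so that both become small at the same times.
  have hGB : ∀ t, 0 ≤ t → ∫ τ in (0 : ℝ)..t, α τ * (gap τ + E τ)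
      ≤ (R z 0 ^ 2 + M z * B) / 2 + B := by
    intro t ht
    simp only [mul_add]
    rw [intervalIntegral.integral_add (hF z t ht) (hαE t ht)]
    have h1 : ∫ τ in (0 : ℝ)..t, α τ * E τ ≤ ∫ τ in (0 : ℝ)..t, α τ * (1 + R z τ) * E τ :=
      intervalIntegral.integral_mono_on ht (hαE t ht) (hg z t ht) fun τ hτ => by
        have := mul_nonneg (mul_nonneg (hα.nonneg τ hτ.1) (hR0 z τ)) (hE0 τ hτ.1)
        linarith
    have h2 := hdiss z 0 t le_rfl ht
    have h3 := mul_le_mul_of_nonneg_left (hB t ht) (hM0 z)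
    linarith [hB t ht, sq_nonneg (R z t)]
  have hsmall : ∀ k : ℕ, ∃ t : ℝ, (k : ℝ) ≤ t ∧ gap t + E t < 1 / ((k : ℝ) + 1) := fun k =>
    exists_lt_of_integral_mul_le (fun t ht => hα.intervalIntegrable ht) hα.nonneg
      hα.exists_lt_integral
      (fun t ht => by simpa only [mul_add] using (hF z t ht).add (hαE t ht))
      (fun t ht => add_nonneg (hgap0 t) (hE0 t ht)) hGB Nat.one_div_pos_of_nat
      (Nat.cast_nonneg k)
  choose T hkT hT using hsmall
  have hT0 : ∀ k, 0 ≤ T k := fun k => (Nat.cast_nonneg k).trans (hkT k)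
  have hTtop : Tendsto T atTop atTop :=
    tendsto_atTop_mono hkT tendsto_natCast_atTop_atTop
  have hgapT : Tendsto (fun k => gap (T k)) atTop (𝓝 0) :=
    squeeze_zero (fun k => hgap0 _) (fun k => by linarith [hT k, hE0 (T k) (hT0 k)])
      tendsto_one_div_add_atTop_nhds_zero_nat
  have hET : Tendsto (fun k => E (T k)) atTop (𝓝 0) :=
    squeeze_zero (fun k => hE0 _ (hT0 k)) (fun k => by linarith [hT k, hgap0 (T k)])
      tendsto_one_div_add_atTop_nhds_zero_nat
  obtain ⟨xs, -, φ, hφ, hlim⟩ := (isCompact_closedBall z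
      (Real.sqrt (R z 0 ^ 2 + M z * B))).tendsto_subseq (x := fun k => average (x (T k)))
    fun k => by
      rw [mem_closedBall_iff_norm]
      refine (norm_average_sub_le hn _ z).trans (Real.le_sqrt_of_sq_le ?_)
      have h1 := hfejer z hz 0 (T k) le_rfl (hT0 k)
      have h2 := mul_le_mul_of_nonneg_left (hB (T k) (hT0 k)) (hM0 z)
      linarith
  have hxs : xs ∈ minimizers f := by
    have h1 : Tendsto (fun k => gap (T (φ k))) atTop (𝓝 (∑ i, f i xs - ∑ i, f i z)) :=
      (tendsto_finsetSum _ fun i _ =>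
        ((hf.differentiable i).continuous.tendsto xs).comp hlim).sub_const _
    have h2 := sub_eq_zero.1 (tendsto_nhds_unique h1 (hgapT.comp hφ.tendsto_atTop))
    intro w
    rw [h2]
    exact hz w
  -- The reference point is now the limit itself: relative to it the distance tends to zero along
  -- the subsequence, hence along all times.
  obtain ⟨B', hB'⟩ := hbound xs hxs
  have hRT : Tendsto (fun k => R xs (T (φ k))) atTop (𝓝 0) := by
    have h1 : Tendsto (fun k => (n : ℝ) * (E (T (φ k)) + ‖average (x (T (φ k))) - xs‖)) atTop
        (𝓝 (n * (0 + 0))) :=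
      ((hET.comp hφ.tendsto_atTop).add (tendsto_iff_norm_sub_tendsto_zero.1 hlim)).const_mul _
    rw [add_zero, mul_zero] at h1
    exact squeeze_zero (fun k => hR0 _ _)
      (fun k => stateNorm_sub_le _ xs (hE _ (hT0 _))) h1
  have hRlim : Tendsto (R xs) atTop (𝓝 0) :=
    tendsto_zero_of_quasiFejer (g := fun τ => M xs * (α τ * (1 + R xs τ) * E τ))
      (fun t ht => (hg xs t ht).const_mul _)
      (fun t ht => mul_nonneg (hM0 xs) (hg0 xs t ht))
      (fun t ht => by
        rw [intervalIntegral.integral_const_mul]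
        exact mul_le_mul_of_nonneg_left (hB' t ht) (hM0 xs))
      (hR0 xs)
      (fun s t hs hst => by
        rw [intervalIntegral.integral_const_mul]
        exact hfejer xs hxs s t hs hst)
      (hTtop.comp hφ.tendsto_atTop) hRT
  refine ⟨xs, hxs, fun i => tendsto_iff_norm_sub_tendsto_zero.2 ?_⟩
  exact squeeze_zero (fun t => norm_nonneg _)
    (fun t => norm_apply_le_stateNorm (fun i => x t i - xs) i) hRlim

end Convergence

end FlowTracker

end

theorem mainTheorem1 {n d : ℕ}
    (L : ℝ → Matrix (Fin n) (Fin n) ℝ)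
    (hL_meas : FlowTracker.IsMeasurableOnHalfLine L)
    (hL_bdd : FlowTracker.IsLocallyEssentiallyBounded L)
    (hL_bal : ∀ t, 0 ≤ t → FlowTracker.IsWeightBalanced (L t))
    (Φ : ℝ → ℝ → Matrix (Fin n) (Fin n) ℝ)
    (hΦ : FlowTracker.IsTransitionFlow L Φ)
    (hΦ_erg : FlowTracker.IsWeaklyExponentiallyErgodic Φ) :
    (FlowTracker.averagingDynamics d L).IsFlowTracker Set.univ ∧
      ∀ α : ℝ → ℝ, FlowTracker.IsStepSize α →
        ∀ f : Fin n → EuclideanSpace ℝ (Fin d) → ℝ, FlowTracker.IsAdmissibleProblem f →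
          ∀ x : ℝ → FlowTracker.State n d,
            FlowTracker.IsCaratheodorySolution
              (fun t z => -FlowTracker.act (L t) z - α t • FlowTracker.stackedGradient f z) 0 x →
            ∃ xstar ∈ FlowTracker.minimizers f,
              ∀ i, Tendsto (fun t => x t i) atTop (𝓝 xstar) := by
  refine ⟨FlowTracker.averagingDynamics_isFlowTracker hL_bal hΦ hΦ_erg,
    fun α hα f hf x hx => ?_⟩
  rcases Nat.eq_zero_or_pos n with rfl | hn
  · obtain ⟨z, hz⟩ := hf.nonempty
    exact ⟨z, hz, fun i => i.elim0⟩
  · refine FlowTracker.exists_tendsto_minimizer hn hL_meas hL_bdd hL_bal hΦ hΦ_erg hα hf ?_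
    exact (FlowTracker.isCaratheodorySolution_iff.1 hx).congr
      (fun τ _ => sub_eq_add_neg _ _) fun _ _ => rfl
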